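/- Let $q$ be a prime power and $n=sk+h$ with integers $s\ge 2$, $s\ne 4$ and $0\le h<k$. For $1\le i\le s-1$ let $\mathbf P_i$ be the companion matrix of a primitive polynomial $x^{d}+a_{d-1}x^{d-1}+\dots+a_0$ of degree $d=ik+h$ over $\mathbb F_q$ (ones above the diagonal, last row $(-a_0,\dots,-a_{d-1})$, zeros elsewhere), and let $G_i$ be the group of the block diagonal $n\times n$ matrices $\operatorname{diag}(\mathbf I_{(s-i-1)k},\mathbf I_k,\mathbf X)$ with $\mathbf X\in\langle \mathbf P_i\rangle$. For a matrix $\mathbf U$ let $\mathbf U^{(j)}$ be the matrix of its first $j$ rows, $\mathbf U^{[j]}$ the matrix that remains after deleting its first $j$ rows, and $\operatorname{rs}(\mathbf U)$ its row space. Define the $(n-1)\times n$ matrices $$\mathbf A_i=\begin{bmatrix}\mathbf 0&\mathbf I_k&\mathbf I_{ik+h}^{(k)}\\ \mathbf 0&\mathbf 0&\mathbf I_{ik+h}^{[k]}\\ \mathbf I_{(s-i-1)k}&\mathbf 0&\mathbf 0\\ \mathbf 0&\mathbf 0&\mathbf I_{ik+h}^{(k-1)}\end{bmatrix},\qquad \mathbf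 B_i=\begin{bmatrix}\mathbf 0&\mathbf I_k&\mathbf 0\\ \mathbf 0&\mathbf 0&\mathbf I_{ik+h}^{[k]}\\ \mathbf I_{(s-i-1)k}&\mathbf 0&\mathbf 0\\ \mathbf 0&\mathbf 0&\mathbf I_{ik+h}^{(k-1)}\end{bmatrix},$$ and let $\mathbf M$ be the $(n-1)\times n$ matrix with rows $e_n,e_{n-1},\dots,e_2$, where $e_j$ is the $j$-th standard unit vector. Let $\mathbf t=(t_1,\dots,t_r)$ be strictly increasing with $$k\in\{t_1,\dots,t_r\}\subseteq\{1,2,\dots,k+h,\,2k+h,\,3k+h,\dots,(s-2)k+h,\,n-k,\dots,n-1\}$$ (the multiples part $2k+h,\dots,(s-2)k+h$ being empty if $s\le 3$), and put $$\mathcal C_{\mathbf t}=\bigl\{\bigl(\operatorname{rs}(\mathbf W^{(t_1)}),\dots,\operatorname{rs}(\mathbf W^{(t_r)})\bigr):\ \mathbf W\in\{\mathbf A_ig,\ \mathbf B_i,\ \mathbf M:\ 1\le i\le s-1,\ g\in G_i\}\bigr\}.$$ A flag code of type $\mathbf t$ on $\mathbb F_q^n$ is a non-empty set $\mathcal C$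 of sequences $(\mathrm F_1,\dots,\mathrm F_r)$ of subspaces of $\mathbb F_q^n$ with $0\subsetneq \mathrm F_1\subsetneq\dots\subsetneq \mathrm F_r\subsetneq\mathbb F_q^n$ and $\dim \mathrm F_i=t_i$. For an index $i$, the set of the $\mathrm F_i$ is its projected code of dimension $t_i$. The code $\mathcal C$ is cardinality-consistent if all its projected codes have cardinality $|\mathcal C|$. A partial $k$-spread is a set of $k$-dimensional subspaces of $\mathbb F_q^n$ any two distinct members of which intersect trivially. If $k>\frac{q^h-1}{q-1}$, then $\mathcal C_{\mathbf t}$ is a cardinality-consistent flag code of type $\mathbf t$ on $\mathbb F_q^n$ whose projected code of dimension $k$ is a partial $k$-spread, $$|\mathcal C_{\mathbf t}|=\sum_{i=1}^{s-1}q^{ik+h}+1=\frac{q^n-q^{k+h}}{q^k-1}+1,$$ and every cardinality-consistent flag code $\mathcal C'$ of type $\mathbf t$ on $\mathbb F_q^n$ whose projected code of dimension $k$ is a partial $k$-spread satisfies $|\mathcal C'|\le|\mathcal C_{\mathbf t}|$. -/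

import Mathlib

open Polynomial

namespace FlagCodes

/-! ### Flag codes on `F ^ n` -/

/-- `𝓕` is a flag of type `t = (t 0, …, t (r - 1))` on `F ^ n`: a strictly increasing sequence of
proper nonzero subspaces, the `i`-th one of dimension `t i`. -/
def IsFlag {F : Type*} [Field F] {n r : ℕ} (t : Fin r → ℕ)
    (𝓕 : Fin r → Submodule F (Fin n → F)) : Prop :=
  StrictMono 𝓕 ∧ (∀ i, ⊥ < 𝓕 i ∧ 𝓕 i < ⊤) ∧ ∀ i, Module.finrank F (𝓕 i) = t i

/-- A flag code of type `t` on `F ^ n`: a nonempty set of flags of type `t`. -/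
def IsFlagCode {F : Type*} [Field F] {n r : ℕ} (t : Fin r → ℕ)
    (C : Set (Fin r → Submodule F (Fin n → F))) : Prop :=
  C.Nonempty ∧ ∀ 𝓕 ∈ C, IsFlag t 𝓕

/-- The `i`-projected code: the set of all `i`-th components of flags in `C`. -/
def projectedCode {F : Type*} [Field F] {n r : ℕ}
    (C : Set (Fin r → Submodule F (Fin n → F))) (i : Fin r) : Set (Submodule F (Fin n → F)) :=
  (fun 𝓕 => 𝓕 i) '' C

/-- `C` is cardinality-consistent: all its projected codes have the same size as `C`. -/
def CardinalityConsistent {F : Type*} [Field F] {n r : ℕ}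
    (C : Set (Fin r → Submodule F (Fin n → F))) : Prop :=
  ∀ i, (projectedCode C i).ncard = C.ncard

/-- `S` is a partial `k`-spread of `F ^ n`: its members are `k`-dimensional, and any two distinct
members intersect trivially. -/
def IsPartialSpread {F : Type*} [Field F] {n : ℕ} (k : ℕ)
    (S : Set (Submodule F (Fin n → F))) : Prop :=
  (∀ U ∈ S, Module.finrank F U = k) ∧ ∀ U ∈ S, ∀ V ∈ S, U ≠ V → U ⊓ V = ⊥

/-! ### The construction -/

/-- `f` is a primitive polynomial over the finite field `F`, in the sense of finite field theory:
monic, irreducible, and its root `x` in `F[x] / (f)`, the field with `|F| ^ deg f` elements,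
generates the multiplicative group of that field. -/
def IsPrimitivePoly {F : Type*} [Field F] [Fintype F] (f : F[X]) : Prop :=
  f.Monic ∧ Irreducible f ∧ orderOf (AdjoinRoot.root f) = Fintype.card F ^ f.natDegree - 1

/-- The companion matrix of a monic polynomial `f` of degree `d`: ones above the diagonal,
last row `(-a₀, -a₁, …, -a_{d-1})`, zeros elsewhere. -/
def companion {F : Type*} [Field F] (d : ℕ) (f : F[X]) : Matrix (Fin d) (Fin d) F :=
  Matrix.of fun a b =>
    if a.val + 1 = d then -f.coeff b.val else if b.val = a.val + 1 then 1 else 0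

/-- The row vector with a `1` at position `j` (counted from `0`) and zeros elsewhere. -/
def unitRow {F : Type*} [Field F] (n j : ℕ) : Fin n → F :=
  fun b => if b.val = j then 1 else 0

/-- The `(n - 1) × n` matrix `A_i`, where `n = s k + h`. With column blocks of widths
`c = (s - i - 1) k`, `k` and `d = i k + h`, its row blocks are, from top to bottom,
`[0, I_k, first k rows of I_d]`, `[0, 0, last d - k rows of I_d]`, `[I_c, 0, 0]` and
`[0, 0, first k - 1 rows of I_d]`. -/
def matA (F : Type*) [Field F] (s k h i : ℕ) :
    Matrix (Fin (s * k + h - 1)) (Fin (s * k + h)) F :=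
  let n := s * k + h
  let c := (s - i - 1) * k
  let d := i * k + h
  Matrix.of fun a =>
    if a.val < k then unitRow n (c + a.val) + unitRow n (c + k + a.val)
    else if a.val < d then unitRow n (c + k + a.val)
    else if a.val < d + c then unitRow n (a.val - d)
    else unitRow n (c + k + (a.val - d - c))

/-- The `(n - 1) × n` matrix `B_i`: as `A_i`, but with first row block `[0, I_k, 0]`. -/
def matB (F : Type*) [Field F] (s k h i : ℕ) :
    Matrix (Fin (s * k + h - 1)) (Fin (s * k + h)) F :=
  let n := s * k + h
  let c := (s - i - 1) * k
  let d := i * k + h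
  Matrix.of fun a =>
    if a.val < k then unitRow n (c + a.val)
    else if a.val < d then unitRow n (c + k + a.val)
    else if a.val < d + c then unitRow n (a.val - d)
    else unitRow n (c + k + (a.val - d - c))

/-- The `(n - 1) × n` matrix `M`, whose rows are the last, the last but one, …, the second
standard unit vector. -/
def matM (F : Type*) [Field F] (s k h : ℕ) :
    Matrix (Fin (s * k + h - 1)) (Fin (s * k + h)) F :=
  Matrix.of fun a => unitRow (s * k + h) (s * k + h - 1 - a.val)

theorem block_widths {s k h i : ℕ} (hi : i + 1 ≤ s) :
    ((s - i - 1) * k + k) + (i * k + h) = s * k + h := by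
  obtain ⟨e, rfl⟩ := Nat.exists_eq_add_of_le hi
  have : i + 1 + e - i - 1 = e := by omega
  rw [this]
  ring

/-- The `n × n` block diagonal matrix `diag(I_{(s-i-1)k}, I_k, X)`, where `X` has size
`i k + h`. -/
def blockDiag {F : Type*} [Field F] {s k h i : ℕ} (hi : i + 1 ≤ s)
    (X : Matrix (Fin (i * k + h)) (Fin (i * k + h)) F) :
    Matrix (Fin (s * k + h)) (Fin (s * k + h)) F :=
  Matrix.reindex (finSumFinEquiv.trans (finCongr (block_widths hi)))
    (finSumFinEquiv.trans (finCongr (block_widths hi)))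
    (Matrix.fromBlocks (1 : Matrix (Fin ((s - i - 1) * k + k)) (Fin ((s - i - 1) * k + k)) F)
      0 0 X)

/-- The cyclic group `G_i` of all `diag(I_{(s-i-1)k}, I_k, X)`, where `X` runs through the powers
of the companion matrix of `f` (an invertible matrix of finite order when `f` is primitive). -/
def groupG {F : Type*} [Field F] {s k h i : ℕ} (hi : i + 1 ≤ s) (f : F[X]) :
    Set (Matrix (Fin (s * k + h)) (Fin (s * k + h)) F) :=
  {g | ∃ X ∈ Submonoid.powers (companion (i * k + h) f), g = blockDiag hi X}

/-- The generator matrices `A_i g` (`g ∈ G_i`), `B_i` (`1 ≤ i ≤ s - 1`) and `M`, where `G_i` is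
built from the polynomial `f i`. -/
def generatorMatrices {F : Type*} [Field F] (s k h : ℕ) (f : ℕ → F[X]) :
    Set (Matrix (Fin (s * k + h - 1)) (Fin (s * k + h)) F) :=
  {W | (∃ i, ∃ hi : 1 ≤ i ∧ i + 1 ≤ s,
          W = matB F s k h i ∨ ∃ g ∈ groupG hi.2 (f i), W = matA F s k h i * g) ∨
        W = matM F s k h}

/-- The space spanned by the first `j` rows of `W`. -/
def firstRows {F : Type*} [Field F] {m n : ℕ} (W : Matrix (Fin m) (Fin n) F) (j : ℕ) :
    Submodule F (Fin n → F) :=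
  Submodule.span F {v | ∃ a : Fin m, a.val < j ∧ v = W a}

/-- The code `C_t`: all sequences of the spaces spanned by the first `t 0`, …, `t (r - 1)` rows of
one of the generator matrices. -/
def codeC {F : Type*} [Field F] (s k h : ℕ) (f : ℕ → F[X]) {r : ℕ} (t : Fin r → ℕ) :
    Set (Fin r → Submodule F (Fin (s * k + h) → F)) :=
  (fun W i => firstRows W (t i)) '' generatorMatrices s k h f

/-- The dimensions `1, 2, …, k + h, 2 k + h, 3 k + h, …, (s - 2) k + h, n - k, …, n - 1`, where
`n = s k + h`. -/
def allowedDims (s k h : ℕ) : Set ℕ :=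
  {m | (1 ≤ m ∧ m ≤ k + h) ∨ (∃ j, 2 ≤ j ∧ j + 2 ≤ s ∧ m = j * k + h) ∨
        (s * k + h ≤ m + k ∧ m + 1 ≤ s * k + h)}

end FlagCodes

namespace FlagCodes

/-! ### Partial spreads: the upper bound by counting uncovered vectors. -/

section Spread

variable {F : Type*} [Field F] [Fintype F] {V : Type*} [AddCommGroup V] [Module F V]
  [Fintype V]

/-! Fix `i` and put `d = i k + h`. The matrices `A_i g` and `B_i` differ only in a head block `X`
and a tail block `Y`: `X = Y` is a power of the companion matrix for `A_i g`, and `X = 0`, `Y = 1`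
for `B_i` (`genRow`). The powers of the companion matrix lie in a copy of the field `F[x] / (f)`, so
any two of these `q ^ d` head blocks (the zero block included) have an invertible difference. This
makes the `k`-spaces meet trivially (`rowSpan_genRow_inf_eq_bot`) and, by a dimension count, keeps
the spaces apart in every dimension (`rowSpan_genRow_ne`).

For different `i` the identity blocks occupy disjoint columns, which settles the intersections in
dimension `k`. Distinctness in the other allowed dimensions comes from a coordinate that vanishes on
only one of the two spaces, or from a unit vector in only one of them
(`rowSpan_genRow_ne_of_widths`). Each matrix extends to a basis of `F ^ n`, so the dimensions are
right and strict inclusion follows. Hence every projected code has one member per label, and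
counting labels gives the cardinality.

For optimality, cardinality-consistency reduces `|C'|` to the size of a partial `k`-spread, bounded
by `card_partialSpread_le`. Suppose there were `Q + 2` members, where `Q = ∑ q ^ (i k + h)`. Call a
vector in no member a hole. Passing repeatedly to a hyperplane with at most a `1 / q` fraction of
the holes, and using that the number of holes is fixed modulo `(q - 1) q ^ (k - j)` in codimension
`j`, the holes run out after `θ = (q ^ h - 1) / (q - 1) < k` steps, although the congruence still
demands some. -/

theorem natCard_functionals_vanishing_at {v : V} (hv : v ≠ 0) :
    Fintype.card F * Nat.card {φ : Module.Dual F V // φ v = 0} =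
      Fintype.card F ^ Module.finrank F V := by
  have hsurj : Function.Surjective (Module.Dual.eval F V v) := by
    apply LinearMap.surjective
    intro h0
    exact hv ((Module.forall_dual_apply_eq_zero_iff F v).1 fun φ => by
      simpa using LinearMap.congr_fun h0 φ)
  have h1 := LinearMap.finrank_range_add_finrank_ker (Module.Dual.eval F V v)
  rw [LinearMap.range_eq_top.2 hsurj, finrank_top, Module.finrank_self,
    Subspace.dual_finrank_eq] at h1
  have h2 : Nat.card {φ : Module.Dual F V // φ v = 0} =
      Nat.card (LinearMap.ker (Module.Dual.eval F V v)) := by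
    apply Nat.card_congr
    exact Equiv.subtypeEquivRight fun φ => by simp
  rw [h2, Module.natCard_eq_pow_finrank (K := F), Nat.card_eq_fintype_card, ← pow_succ',
    ← h1, add_comm]

open Classical in
-- Averaging over the kernels of the nonzero functionals: a nonzero vector is killed by `q ^ (m - 1)
-- - 1` of the `q ^ m - 1` nonzero functionals, a proportion below `1 / q`.
theorem exists_hyperplane_few_points (hV : 0 < Module.finrank F V) (N : Finset V)
    (hN : (0 : V) ∉ N) :
    ∃ H : Submodule F V, Module.finrank F H + 1 = Module.finrank F V ∧
      Fintype.card F * (N.filter (· ∈ H)).card ≤ N.card := by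
  have : Finite (Module.Dual F V) := Finite.of_injective _ DFunLike.coe_injective
  have := Fintype.ofFinite (Module.Dual F V)
  set q := Fintype.card F with hq
  set m := Module.finrank F V with hm
  have hq2 : 1 < q := Fintype.one_lt_card
  have hdual : Fintype.card (Module.Dual F V) = q ^ m := by
    rw [← Nat.card_eq_fintype_card, Module.natCard_eq_pow_finrank (K := F),
      Subspace.dual_finrank_eq, Nat.card_eq_fintype_card]
  by_contra! hcon
  let D : Finset (Module.Dual F V) := Finset.univ.erase 0
  have hD : D.card + 1 = q ^ m := by
    rw [Finset.card_erase_add_one (Finset.mem_univ _), Finset.card_univ, hdual]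
  have hker : ∀ φ ∈ D, N.card + 1 ≤ q * (N.filter (φ · = 0)).card := by
    intro φ hφ
    have hφ0 : φ ≠ 0 := Finset.ne_of_mem_erase hφ
    have h1 := LinearMap.finrank_range_add_finrank_ker φ
    rw [LinearMap.range_eq_top.2 (LinearMap.surjective hφ0), finrank_top,
      Module.finrank_self] at h1
    have := hcon (LinearMap.ker φ) (by omega)
    simpa [LinearMap.mem_ker] using this
  have hsum := Finset.sum_le_sum hker
  rw [Finset.sum_const, smul_eq_mul, ← Finset.mul_sum] at hsum
  have hswap : ∑ φ ∈ D, (N.filter (φ · = 0)).card =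
      ∑ v ∈ N, (D.filter (fun φ => φ v = 0)).card := by
    simp only [Finset.card_filter]
    exact Finset.sum_comm
  have hpt : ∀ v ∈ N, q * (D.filter (fun φ => φ v = 0)).card + q = q ^ m := by
    intro v hv
    have hv0 : v ≠ 0 := fun h => hN (h ▸ hv)
    rw [← natCard_functionals_vanishing_at (F := F) hv0, Nat.card_eq_fintype_card,
      Fintype.card_subtype, ← hq, Finset.filter_erase, ← mul_add_one,
      Finset.card_erase_add_one (by simp)]
  have hsum2 : ∑ v ∈ N, (q * (D.filter (fun φ => φ v = 0)).card + q) = N.card * q ^ m := by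
    rw [Finset.sum_congr rfl hpt, Finset.sum_const, smul_eq_mul]
  rw [Finset.sum_add_distrib, ← Finset.mul_sum, Finset.sum_const, smul_eq_mul, ← hswap] at hsum2
  have hDpos : 0 < D.card := by
    have : 1 < q ^ m := Nat.one_lt_pow hV.ne' hq2
    omega
  -- The two counts of incident pairs leave `D.card + N.card * q ≤ N.card`, impossible since `q > 1`
  -- and `D` is nonempty.
  have : D.card * (N.card + 1) + N.card * q ≤ N.card * (D.card + 1) := by
    rw [hD]; omega
  nlinarith

open Classical in
/-- The number of vectors of `W` in none of the members of `S`. -/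
noncomputable def holes (S : Finset (Submodule F V)) (W : Submodule F V) : ℕ :=
  (Finset.univ.filter fun v : V => v ∈ W ∧ ∀ U ∈ S, v ∉ U).card

open Classical in
theorem card_filter_mem_ne_zero (W : Submodule F V) :
    ((Finset.univ.filter fun v : V => v ∈ W ∧ v ≠ 0).card : ℤ) =
      (Fintype.card F : ℤ) ^ Module.finrank F W - 1 := by
  have h1 : Finset.univ.filter (fun v : V => v ∈ W ∧ v ≠ 0) =
      (Finset.univ.filter fun v : V => v ∈ W).erase 0 := by
    ext v; simp [and_comm]
  have h2 : (Finset.univ.filter fun v : V => v ∈ W).card =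
      Fintype.card F ^ Module.finrank F W := by
    rw [← Fintype.card_subtype, ← Nat.card_eq_fintype_card, ← Nat.card_eq_fintype_card]
    exact Module.natCard_eq_pow_finrank (K := F) (V := W)
  have h3 := Finset.card_erase_add_one (s := Finset.univ.filter fun v : V => v ∈ W)
    (a := 0) (by simp)
  rw [h1]
  rw [h2] at h3
  have : (Fintype.card F : ℤ) ^ Module.finrank F W =
    ((Fintype.card F ^ Module.finrank F W : ℕ) : ℤ) := by push_cast; rfl
  rw [this, ← h3]
  push_cast; ring

/-- Every nonzero vector of `W` is either a hole or in exactly one member of `S`. Nonemptiness of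
`S` keeps the zero vector from being a hole. -/
theorem holes_add_sum {S : Finset (Submodule F V)} (hS : S.Nonempty)
    (hdis : ∀ U ∈ S, ∀ U' ∈ S, U ≠ U' → U ⊓ U' = ⊥) (W : Submodule F V) :
    (holes S W : ℤ) + ∑ U ∈ S, ((Fintype.card F : ℤ) ^ Module.finrank F (U ⊓ W : Submodule F V) - 1)
      = (Fintype.card F : ℤ) ^ Module.finrank F W - 1 := by
  classical
  simp only [← card_filter_mem_ne_zero, holes, Finset.card_filter]
  push_cast
  rw [Finset.sum_comm, ← Finset.sum_add_distrib]
  apply Finset.sum_congr rfl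
  intro v _
  obtain ⟨U₀, hU₀⟩ := hS
  by_cases hv0 : v = 0
  · subst hv0
    simpa using ⟨U₀, hU₀⟩
  by_cases hW : v ∈ W
  · by_cases hc : ∃ U ∈ S, v ∈ U
    · obtain ⟨U, hU, hvU⟩ := hc
      have h1 : ¬ ∀ U ∈ S, v ∉ U := fun h => h U hU hvU
      rw [Finset.sum_eq_single_of_mem U hU]
      · simp [h1, hv0, hW, hvU]
      · intro U' hU' hne
        have : v ∉ U' := fun hvU' => hv0 (by
          have : v ∈ U' ⊓ U := ⟨hvU', hvU⟩
          rw [hdis U' hU' U hU hne] at this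
          simpa using this)
        simp [this]
    · push Not at hc
      rw [Finset.sum_eq_zero]
      · simpa [hv0, hW] using hc
      · intro U hU
        simp [hc U hU]
  · simp [hW]

theorem exists_hyperplane_few_holes {S : Finset (Submodule F V)} (hS : S.Nonempty)
    (W : Submodule F V) (hW : 0 < Module.finrank F W) :
    ∃ W' : Submodule F V, Module.finrank F W' + 1 = Module.finrank F W ∧
      Fintype.card F * holes S W' ≤ holes S W := by
  classical
  obtain ⟨U₀, hU₀⟩ := hS
  let N : Finset W := Finset.univ.filter fun v => ∀ U ∈ S, (v : V) ∉ U
  obtain ⟨H, hH, hle⟩ := exists_hyperplane_few_points (F := F) hW N (by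
    simp only [N, Finset.mem_filter, not_and]
    intro _ h
    exact h U₀ hU₀ U₀.zero_mem)
  refine ⟨H.map W.subtype, ?_, ?_⟩
  · rw [← hH, Submodule.finrank_map_subtype_eq]
  · have e1 : holes S (H.map W.subtype) = (N.filter (· ∈ H)).card := by
      unfold holes
      rw [← Finset.card_map (Function.Embedding.subtype (· ∈ W))]
      congr 1
      ext v
      simp only [N, Finset.mem_filter, Finset.mem_univ, Finset.mem_map, Submodule.mem_map,
        Function.Embedding.subtype_apply, Submodule.subtype_apply, true_and]
      constructor
      · rintro ⟨⟨w, hw, rfl⟩, h⟩; exact ⟨w, ⟨h, hw⟩, rfl⟩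
      · rintro ⟨w, ⟨h, hw⟩, rfl⟩; exact ⟨⟨w, hw, rfl⟩, h⟩
    have e2 : holes S W = N.card := by
      unfold holes
      rw [← Finset.card_map (Function.Embedding.subtype (· ∈ W))]
      congr 1
      ext v
      simp [N, and_comm]
    rw [e1, e2]
    exact hle

theorem sub_one_mul_pow_dvd (q : ℤ) {p m : ℕ} (hpm : p ≤ m) :
    (q - 1) * q ^ p ∣ q ^ m - q ^ p := by
  obtain ⟨e, rfl⟩ := Nat.exists_eq_add_of_le hpm
  have : q ^ (p + e) - q ^ p = (q ^ e - 1) * q ^ p := by ring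
  rw [this]
  exact mul_dvd_mul_right (sub_one_dvd_pow_sub_one q e) _

/-- Modulo `(q - 1) q ^ p`, with `p = k - j`, all powers `q ^ m` with `m ≥ p` agree. A subspace of
codimension `j` meets each member in dimension at least `p`, so every term of the count becomes `q ^
p - 1`, and `Q (q ^ p - 1)` drops out because `q ^ k` divides `Q`. -/
theorem dvd_holes {S : Finset (Submodule F V)} {k Q : ℕ}
    (hSk : ∀ U ∈ S, Module.finrank F U = k)
    (hdis : ∀ U ∈ S, ∀ U' ∈ S, U ≠ U' → U ⊓ U' = ⊥)
    (hcard : S.card = Q + 2) (hQ : Fintype.card F ^ k ∣ Q)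
    {j : ℕ} (hjk : j ≤ k) (hk : k ≤ Module.finrank F V) {W : Submodule F V}
    (hW : Module.finrank F W + j = Module.finrank F V) :
    ((Fintype.card F : ℤ) - 1) * (Fintype.card F : ℤ) ^ (k - j) ∣
      holes S W + (Fintype.card F : ℤ) ^ (k - j) - 1 := by
  have hS : S.Nonempty := Finset.card_pos.1 (by omega)
  have hcount := holes_add_sum hS hdis W
  set q : ℤ := (Fintype.card F : ℤ) with hq
  set p := k - j
  have h1 : (q - 1) * q ^ p ∣ q ^ Module.finrank F W - q ^ p :=
    sub_one_mul_pow_dvd q (by omega)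
  have h2 : (q - 1) * q ^ p ∣
      ∑ U ∈ S, (q ^ Module.finrank F (U ⊓ W : Submodule F V) - q ^ p) := by
    refine Finset.dvd_sum fun U hU => sub_one_mul_pow_dvd q ?_
    have a := Submodule.finrank_sup_add_finrank_inf_eq U W
    have b := Submodule.finrank_le (U ⊔ W)
    have := hSk U hU
    omega
  have h3 : (q - 1) * q ^ p ∣ (Q : ℤ) * (q ^ p - 1) := by
    have : q ^ p ∣ (Q : ℤ) := by
      refine (pow_dvd_pow q (Nat.sub_le k j)).trans ?_
      rw [hq]; exact_mod_cast hQ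
    rw [mul_comm]
    exact mul_dvd_mul this (sub_one_dvd_pow_sub_one q p)
  have : (holes S W : ℤ) + q ^ p - 1 = (q ^ Module.finrank F W - q ^ p) -
      ∑ U ∈ S, (q ^ Module.finrank F (U ⊓ W : Submodule F V) - q ^ p) - Q * (q ^ p - 1) := by
    rw [Finset.sum_sub_distrib, Finset.sum_const, hcard, nsmul_eq_mul] at hcount ⊢
    push_cast at *
    linear_combination hcount
  rw [this]
  exact (h1.sub h2).sub h3

/-- Equality holds for `j = 0`. Each further hyperplane section divides the bound by `q`, and
divisibility turns the resulting strict inequality into a loss of a whole unit in the factor `θ -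
j`. -/
theorem exists_subspace_few_holes {S : Finset (Submodule F V)} {k h Q θ : ℕ}
    (hSk : ∀ U ∈ S, Module.finrank F U = k)
    (hdis : ∀ U ∈ S, ∀ U' ∈ S, U ≠ U' → U ⊓ U' = ⊥)
    (hcard : S.card = Q + 2) (hQ : Fintype.card F ^ k ∣ Q)
    (hk : k ≤ Module.finrank F V)
    (hQn : (Q : ℤ) * ((Fintype.card F : ℤ) ^ k - 1) =
      (Fintype.card F : ℤ) ^ Module.finrank F V - (Fintype.card F : ℤ) ^ (k + h))
    (hθ : (θ : ℤ) * ((Fintype.card F : ℤ) - 1) = (Fintype.card F : ℤ) ^ h - 1)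
    (j : ℕ) (hjk : j ≤ k) :
    ∃ W : Submodule F V, Module.finrank F W + j = Module.finrank F V ∧
      (holes S W : ℤ) + (Fintype.card F : ℤ) ^ (k - j) - 1 ≤
        ((Fintype.card F : ℤ) - 1) * (Fintype.card F : ℤ) ^ (k - j) * (θ - j) := by
  have hS : S.Nonempty := Finset.card_pos.1 (by omega)
  have hq1 : (1 : ℤ) < Fintype.card F := by exact_mod_cast Fintype.one_lt_card
  induction j with
  | zero =>
    refine ⟨⊤, by simp, ?_⟩
    have := holes_add_sum hS hdis ⊤
    have hsum : ∑ U ∈ S, ((Fintype.card F : ℤ) ^ Module.finrank F (U ⊓ ⊤ : Submodule F V) - 1) =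
        ∑ U ∈ S, ((Fintype.card F : ℤ) ^ k - 1) :=
      Finset.sum_congr rfl fun U hU => by rw [inf_top_eq, hSk U hU]
    rw [hsum, Finset.sum_const, hcard, nsmul_eq_mul, finrank_top] at this
    push_cast at this ⊢
    simp only [Nat.sub_zero]
    rw [pow_add] at hQn
    apply le_of_eq
    linear_combination this - hQn - (Fintype.card F : ℤ) ^ k * hθ
  | succ j ih =>
    obtain ⟨W, hW, hle⟩ := ih (by omega)
    obtain ⟨W', hW', hle'⟩ := exists_hyperplane_few_holes hS W (by omega)
    refine ⟨W', by omega, ?_⟩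
    obtain ⟨y, hy⟩ := dvd_holes hSk hdis hcard hQ hjk hk (W := W') (by omega)
    obtain ⟨p, hp⟩ : ∃ p, k - j = p + 1 := ⟨k - j - 1, by omega⟩
    rw [show k - (j + 1) = p by omega] at hy ⊢
    rw [hp] at hle
    zify at hle'
    set q : ℤ := (Fintype.card F : ℤ)
    have hD : 0 < (q - 1) * q ^ p * q := by
      have : 0 < q - 1 := by linarith
      positivity
    -- Strict because multiplying `holes + q ^ p - 1` by `q` turns the constant `-1` into `-q`,
    -- below the `-1` available for `W`.
    have hlt : (q - 1) * q ^ p * q * y < (q - 1) * q ^ p * q * (θ - j) := by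
      rw [pow_succ] at hle
      nlinarith
    have hy' : y + 1 ≤ (θ : ℤ) - j := lt_of_mul_lt_mul_left hlt hD.le
    rw [hy]
    apply mul_le_mul_of_nonneg_left
    · push_cast; linarith
    · have : 0 < q - 1 := by linarith
      positivity

/-- The bound of Năstase and Sissokho on the size of a partial `k`-spread. -/
theorem card_partialSpread_le {S : Finset (Submodule F V)} {k h Q θ : ℕ}
    (hSk : ∀ U ∈ S, Module.finrank F U = k)
    (hdis : ∀ U ∈ S, ∀ U' ∈ S, U ≠ U' → U ⊓ U' = ⊥)
    (hQ : Fintype.card F ^ k ∣ Q)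
    (hk : k ≤ Module.finrank F V)
    (hQn : (Q : ℤ) * ((Fintype.card F : ℤ) ^ k - 1) =
      (Fintype.card F : ℤ) ^ Module.finrank F V - (Fintype.card F : ℤ) ^ (k + h))
    (hθ : (θ : ℤ) * ((Fintype.card F : ℤ) - 1) = (Fintype.card F : ℤ) ^ h - 1)
    (hθk : θ < k) : S.card ≤ Q + 1 := by
  by_contra! hlt
  obtain ⟨T, hTS, hT⟩ := Finset.exists_subset_card_eq (show Q + 2 ≤ S.card by omega)
  -- In codimension `θ` the upper bound is zero, while the left side is at least `q ^ (k - θ) - 1 >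
  -- 0`.
  obtain ⟨W, -, hle⟩ := exists_subspace_few_holes (S := T) (fun U hU => hSk U (hTS hU))
    (fun U hU U' hU' => hdis U (hTS hU) U' (hTS hU')) hT hQ hk hQn hθ θ hθk.le
  have hq1 : 1 < Fintype.card F := Fintype.one_lt_card
  have : (1 : ℤ) < (Fintype.card F : ℤ) ^ (k - θ) := by
    exact_mod_cast Nat.one_lt_pow (by omega) hq1
  simp only [sub_self, mul_zero] at hle
  omega

end Spread

/-! ### Companion matrices of primitive polynomials. -/

section Companion

open Matrix

variable {F : Type*} [Field F]

theorem unitRow_eq_single {n j : ℕ} (hj : j < n) :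
    unitRow n j = (Pi.single ⟨j, hj⟩ 1 : Fin n → F) := by
  funext b
  simp [unitRow, Pi.single_apply, Fin.ext_iff]

theorem unitRow_vecMul {n m j : ℕ} (hj : j < n) (X : Matrix (Fin n) (Fin m) F) :
    unitRow n j ᵥ* X = X ⟨j, hj⟩ := by
  rw [unitRow_eq_single hj, single_one_vecMul]
  rfl

theorem unitRow_vecMul_companion {d a : ℕ} (ha : a + 1 < d) (f : F[X]) :
    unitRow d a ᵥ* companion d f = unitRow d (a + 1) := by
  rw [unitRow_vecMul (by omega)]
  funext b
  simp [companion, unitRow, ha.ne]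

theorem unitRow_vecMul_companion_pow {d a : ℕ} (ha : a < d) (f : F[X]) :
    unitRow d 0 ᵥ* companion d f ^ a = unitRow d a := by
  induction a with
  | zero => simp
  | succ a ih => rw [pow_succ, ← vecMul_vecMul, ih (by omega), unitRow_vecMul_companion ha]

/-- The first unit row is cyclic: its images under the powers below `d` are all the unit rows. The
last row of the companion matrix makes `f` annihilate the first unit row, and commuting with powers
carries this to the others. -/
theorem aeval_companion {d : ℕ} (hd : 0 < d) {f : F[X]} (hf : f.Monic) (hfd : f.natDegree = d) :
    aeval (companion d f) f = 0 := by
  have h0 : unitRow d 0 ᵥ* aeval (companion d f) f = 0 := by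
    obtain ⟨e, rfl⟩ : ∃ e, d = e + 1 := ⟨d - 1, by omega⟩
    rw [aeval_eq_sum_range, hfd, vecMul_sum, Finset.sum_range_succ, ← hfd, hf.coeff_natDegree,
      one_smul, hfd, pow_succ, ← vecMul_vecMul, unitRow_vecMul_companion_pow (by omega),
      unitRow_vecMul (by omega)]
    funext b
    rw [Pi.add_apply, Finset.sum_apply, Finset.sum_eq_single_of_mem b.val (Finset.mem_range.2 b.isLt)]
    · rw [vecMul_smul, unitRow_vecMul_companion_pow b.isLt]
      simp [unitRow, companion]
    · intro a ha hab
      rw [vecMul_smul, unitRow_vecMul_companion_pow (Finset.mem_range.1 ha)]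
      simp [unitRow, hab.symm]
  refine Matrix.ext_of_single_vecMul fun a => ?_
  rw [← unitRow_eq_single a.isLt, ← unitRow_vecMul_companion_pow a.isLt f, vecMul_vecMul,
    vecMul_zero]
  have : companion d f ^ a.val * aeval (companion d f) f =
      aeval (companion d f) f * companion d f ^ a.val := by
    have := congrArg (aeval (companion d f)) (mul_comm (X ^ a.val) f)
    simpa using this
  rw [this, ← vecMul_vecMul, h0, zero_vecMul]

/-- The embedding of the field `F[x] / (f)` into the matrix ring that maps the root of `f` to the
companion matrix. -/
noncomputable def companionHom {d : ℕ} (hd : 0 < d) {f : F[X]} (hf : f.Monic)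
    (hfd : f.natDegree = d) : AdjoinRoot f →+* Matrix (Fin d) (Fin d) F :=
  Ideal.Quotient.lift (Ideal.span {f}) (aeval (companion d f) : F[X] →ₐ[F] _).toRingHom (by
    intro g hg
    obtain ⟨u, rfl⟩ := Ideal.mem_span_singleton'.1 hg
    simp [aeval_companion hd hf hfd])

theorem companionHom_root {d : ℕ} (hd : 0 < d) {f : F[X]} (hf : f.Monic)
    (hfd : f.natDegree = d) :
    companionHom hd hf hfd (AdjoinRoot.root f) = companion d f := by
  change Ideal.Quotient.lift _ _ _ (Ideal.Quotient.mk _ X) = _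
  rw [Ideal.Quotient.lift_mk]
  simp

variable [Fintype F]

theorem IsPrimitivePoly.root_ne_zero {f : F[X]} (hf : IsPrimitivePoly f)
    (hd : 0 < f.natDegree) : AdjoinRoot.root f ≠ 0 := by
  have := Fact.mk hf.2.1
  intro h0
  have h := pow_orderOf_eq_one (AdjoinRoot.root f)
  have h1 : 1 < Fintype.card F ^ f.natDegree := Nat.one_lt_pow hd.ne' Fintype.one_lt_card
  rw [hf.2.2, h0, zero_pow (by omega)] at h
  exact zero_ne_one h

theorem isUnit_of_mem_powers_companion {d : ℕ} (hd : 0 < d) {f : F[X]} (hf : IsPrimitivePoly f)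
    (hfd : f.natDegree = d) {X : Matrix (Fin d) (Fin d) F}
    (hX : X ∈ Submonoid.powers (companion d f)) : IsUnit X := by
  have := Fact.mk hf.2.1
  obtain ⟨a, rfl⟩ := hX
  rw [← companionHom_root hd hf.1 hfd]
  exact ((isUnit_iff_ne_zero.2 (hf.root_ne_zero (by omega))).map _).pow _

/-- Both powers come from the field `F[x] / (f)`, where a nonzero difference is invertible. -/
theorem isUnit_sub_of_mem_powers_companion {d : ℕ} (hd : 0 < d) {f : F[X]}
    (hf : IsPrimitivePoly f) (hfd : f.natDegree = d) {X Y : Matrix (Fin d) (Fin d) F}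
    (hX : X ∈ Submonoid.powers (companion d f)) (hY : Y ∈ Submonoid.powers (companion d f))
    (hXY : X ≠ Y) : IsUnit (X - Y) := by
  have := Fact.mk hf.2.1
  obtain ⟨a, rfl⟩ := hX
  obtain ⟨b, rfl⟩ := hY
  simp only [← companionHom_root hd hf.1 hfd, ← map_pow, ← map_sub] at hXY ⊢
  exact (isUnit_iff_ne_zero.2 (sub_ne_zero.2 fun h => hXY (congrArg _ h))).map _

theorem natCard_powers_companion {d : ℕ} (hd : 0 < d) {f : F[X]} (hf : IsPrimitivePoly f)
    (hfd : f.natDegree = d) :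
    Nat.card (Submonoid.powers (companion d f)) = Fintype.card F ^ d - 1 := by
  have := Fact.mk hf.2.1
  have : Nonempty (Fin d) := ⟨⟨0, hd⟩⟩
  have hord : orderOf (companion d f) = Fintype.card F ^ d - 1 := by
    have hroot := hf.2.2
    rw [hfd] at hroot
    rw [← companionHom_root hd hf.1 hfd, ← hroot]
    exact orderOf_injective (companionHom hd hf.1 hfd).toMonoidHom
      (companionHom hd hf.1 hfd).injective _
  have h1 : 1 < Fintype.card F ^ d := Nat.one_lt_pow hd.ne' Fintype.one_lt_card
  have hfin : IsOfFinOrder (companion d f) := orderOf_pos_iff.1 (by omega)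
  rw [← Nat.card_congr (finEquivPowers hfin), Nat.card_eq_fintype_card, Fintype.card_fin, hord]

end Companion

/-! ### Row spaces of the generator matrices for a single block structure. -/

section Rows

open Matrix

variable {F : Type*} [Field F]

/-- The `b`-th coordinate of a row vector, which is zero for `b` out of range. -/
def coord (F : Type*) [Field F] (n b : ℕ) : (Fin n → F) →ₗ[F] F :=
  if h : b < n then LinearMap.proj ⟨b, h⟩ else 0

theorem coord_val {n : ℕ} (b : Fin n) (v : Fin n → F) : coord F n b.val v = v b := by
  simp [coord]

theorem coord_of_le {n b : ℕ} (h : n ≤ b) (v : Fin n → F) : coord F n b v = 0 := by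
  simp [coord, h.not_gt]

theorem coord_unitRow {n b j : ℕ} (hb : b < n) :
    coord F n b (unitRow n j) = if b = j then 1 else 0 := by
  simp [coord, unitRow, hb]

theorem coord_unitRow_of_ne {n b j : ℕ} (hbj : b ≠ j) : coord F n b (unitRow n j) = 0 := by
  rcases lt_or_ge b n with hb | hb
  · simp [coord_unitRow hb, hbj]
  · exact coord_of_le hb _

/-- The embedding of `F ^ d` into `F ^ n` as the coordinates from `o` on. -/
def shift (F : Type*) [Field F] (n o d : ℕ) : (Fin d → F) →ₗ[F] (Fin n → F) :=
  LinearMap.pi fun b => if o ≤ b.val then coord F d (b.val - o) else 0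

theorem coord_shift {n o d b : ℕ} (hn : b < n) (x : Fin d → F) :
    coord F n b (shift F n o d x) = if o ≤ b then coord F d (b - o) x else 0 := by
  have : coord F n b (shift F n o d x) = shift F n o d x ⟨b, hn⟩ := coord_val ⟨b, hn⟩ _
  rw [this]
  simp only [shift, LinearMap.pi_apply]
  split_ifs <;> rfl

theorem coord_shift_of_lt {n o d b : ℕ} (hb : b < o) (x : Fin d → F) :
    coord F n b (shift F n o d x) = 0 := by
  rcases lt_or_ge b n with h | h
  · rw [coord_shift h, if_neg (by omega)]
  · exact coord_of_le h _

theorem shift_unitRow (n o d a : ℕ) (ha : a < d) :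
    shift F n o d (unitRow d a) = unitRow n (o + a) := by
  funext b
  rw [← coord_val b (shift F n o d _), ← coord_val b (unitRow n (o + a)), coord_shift b.isLt,
    coord_unitRow b.isLt]
  by_cases hb : o ≤ b.val
  · rw [if_pos hb]
    by_cases h : b.val - o < d
    · rw [coord_unitRow h]
      congr 1
      apply propext; omega
    · rw [coord_of_le (by omega), if_neg (by omega)]
  · rw [if_neg hb, if_neg (by omega)]

/-- The restriction of a row vector to the `d` coordinates from `o` on. -/
def window (F : Type*) [Field F] (n o d : ℕ) : (Fin n → F) →ₗ[F] (Fin d → F) :=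
  LinearMap.pi fun a => coord F n (o + a.val)

theorem window_shift {n o d : ℕ} (hn : o + d ≤ n) (x : Fin d → F) :
    window F n o d (shift F n o d x) = x := by
  funext a
  have := a.isLt
  simp only [window, LinearMap.pi_apply]
  rw [coord_shift (by omega), if_pos (by omega)]
  simp [coord_val]

theorem window_unitRow_of_lt {n o d j : ℕ} (hj : j < o) :
    window F n o d (unitRow n j) = 0 := by
  funext a
  exact coord_unitRow_of_ne (by omega)

/-- The restriction of a row vector to the `k` coordinates from `c` on, followed by zeros. -/
def headWindow (F : Type*) [Field F] (n c k d : ℕ) : (Fin n → F) →ₗ[F] (Fin d → F) :=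
  LinearMap.pi fun a => if a.val < k then coord F n (c + a.val) else 0

theorem headWindow_shift (n c k d e : ℕ) (x : Fin e → F) :
    headWindow F n c k d (shift F n (c + k) e x) = 0 := by
  funext a
  simp only [headWindow, LinearMap.pi_apply]
  split_ifs
  · exact coord_shift_of_lt (by omega) x
  · rfl

theorem headWindow_unitRow_of_lt {n c k d j : ℕ} (hj : j < c) :
    headWindow F n c k d (unitRow n j) = 0 := by
  funext a
  simp only [headWindow, LinearMap.pi_apply]
  split_ifs
  · exact coord_unitRow_of_ne (by omega)
  · rfl

theorem headWindow_unitRow {n c k d a : ℕ} (ha : a < k) (hn : c + k ≤ n) :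
    headWindow F n c k d (unitRow n (c + a)) = unitRow d a := by
  funext b
  simp only [headWindow, LinearMap.pi_apply]
  split_ifs
  · rw [coord_unitRow (by omega), unitRow]
    congr 1
    apply propext; omega
  · have : b.val ≠ a := by omega
    simp [unitRow, this]

/-- The span of the first `m` rows of a sequence of rows. -/
def rowSpan {n : ℕ} (w : ℕ → Fin n → F) (m : ℕ) : Submodule F (Fin n → F) :=
  Submodule.span F {v | ∃ a < m, v = w a}

theorem mem_rowSpan {n a m : ℕ} {w : ℕ → Fin n → F} (ha : a < m) : w a ∈ rowSpan w m :=
  Submodule.subset_span ⟨a, ha, rfl⟩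

theorem rowSpan_le {n m : ℕ} {w : ℕ → Fin n → F} {K : Submodule F (Fin n → F)}
    (h : ∀ a < m, w a ∈ K) : rowSpan w m ≤ K := by
  refine Submodule.span_le.2 ?_
  rintro _ ⟨a, ha, rfl⟩
  exact h a ha

theorem rowSpan_mono {n m m' : ℕ} (w : ℕ → Fin n → F) (h : m ≤ m') :
    rowSpan w m ≤ rowSpan w m' :=
  rowSpan_le fun _ ha => mem_rowSpan (ha.trans_le h)

theorem map_eq_zero_of_mem_rowSpan {n m : ℕ} {w : ℕ → Fin n → F} {E : Type*} [AddCommGroup E]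
    [Module F E] (φ : (Fin n → F) →ₗ[F] E) (h : ∀ a < m, φ (w a) = 0) {v : Fin n → F}
    (hv : v ∈ rowSpan w m) : φ v = 0 :=
  (rowSpan_le (K := LinearMap.ker φ) fun a ha => h a ha) hv

theorem unitRows_span {n : ℕ} {K : Submodule F (Fin n → F)} (h : ∀ b < n, unitRow n b ∈ K) :
    K = ⊤ := by
  rw [eq_top_iff, ← (Pi.basisFun F (Fin n)).span_eq, Submodule.span_le]
  rintro _ ⟨b, rfl⟩
  rw [Pi.basisFun_apply, ← unitRow_eq_single b.isLt]
  exact h b b.isLt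

theorem finrank_rowSpan {n m : ℕ} {w : ℕ → Fin n → F} (hw : rowSpan w n = ⊤) (hm : m ≤ n) :
    Module.finrank F (rowSpan w m) = m := by
  have h1 : LinearIndependent F (fun a : Fin n => w a.val) := by
    apply linearIndependent_of_top_le_span_of_card_eq_finrank
    · rw [← hw]
      refine rowSpan_le fun a ha => Submodule.subset_span ⟨⟨a, ha⟩, rfl⟩
    · simp
  have h2 := h1.comp (Fin.castLE hm) (Fin.castLE_injective hm)
  have h3 := finrank_span_eq_card h2
  rw [Fintype.card_fin] at h3
  refine Eq.trans (congrArg (fun s => Module.finrank F (Submodule.span F s)) ?_) h3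
  ext v
  constructor
  · rintro ⟨a, ha, rfl⟩; exact ⟨⟨a, ha⟩, rfl⟩
  · rintro ⟨a, rfl⟩; exact ⟨a, a.isLt, rfl⟩

/-- The rows that `A_i g` and `B_i` have in common: with `X = Y` the matrix of the last block of
`g` they are the rows of `A_i g`, with `X = 0` and `Y = 1` those of `B_i`. -/
def genRow (n c k d : ℕ) (X Y : Matrix (Fin d) (Fin d) F) (a : ℕ) : Fin n → F :=
  if a < k then unitRow n (c + a) + shift F n (c + k) d (unitRow d a ᵥ* X)
  else if a < d then shift F n (c + k) d (unitRow d a ᵥ* Y)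
  else if a < d + c then unitRow n (a - d)
  else shift F n (c + k) d (unitRow d (a - d - c) ᵥ* Y)

theorem genRow_of_lt {n c k d a : ℕ} (X Y : Matrix (Fin d) (Fin d) F) (ha : a < k) :
    genRow n c k d X Y a = unitRow n (c + a) + shift F n (c + k) d (unitRow d a ᵥ* X) :=
  if_pos ha

theorem genRow_of_le_of_lt {n c k d a : ℕ} (X Y : Matrix (Fin d) (Fin d) F) (hka : k ≤ a)
    (had : a < d) : genRow n c k d X Y a = shift F n (c + k) d (unitRow d a ᵥ* Y) := by
  rw [genRow, if_neg (by omega), if_pos had]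

theorem genRow_add {n c k d b : ℕ} (X Y : Matrix (Fin d) (Fin d) F) (hkd : k ≤ d) (hb : b < c) :
    genRow n c k d X Y (d + b) = unitRow n b := by
  rw [genRow, if_neg (by omega), if_neg (by omega), if_pos (by omega)]
  congr 1
  omega

theorem genRow_add_add {n c k d : ℕ} (a : ℕ) (X Y : Matrix (Fin d) (Fin d) F) (hkd : k ≤ d) :
    genRow n c k d X Y (d + c + a) = shift F n (c + k) d (unitRow d a ᵥ* Y) := by
  rw [genRow, if_neg (by omega), if_neg (by omega), if_neg (by omega)]
  congr 3
  omega

theorem rowSpan_genRow_le {n c k d m : ℕ} {X Y : Matrix (Fin d) (Fin d) F} (hkd : k ≤ d)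
    {K : Submodule F (Fin n → F)}
    (h1 : ∀ a, a < k → a < m → unitRow n (c + a) + shift F n (c + k) d (unitRow d a ᵥ* X) ∈ K)
    (h2 : ∀ a, k ≤ a → a < d → a < m → shift F n (c + k) d (unitRow d a ᵥ* Y) ∈ K)
    (h3 : ∀ b, b < c → b < m - d → unitRow n b ∈ K)
    (h4 : ∀ a, a < m - d - c → shift F n (c + k) d (unitRow d a ᵥ* Y) ∈ K) :
    rowSpan (genRow n c k d X Y) m ≤ K := by
  refine rowSpan_le fun a ha => ?_
  rcases lt_or_ge a k with hk | hk
  · rw [genRow_of_lt _ _ hk]; exact h1 a hk ha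
  rcases lt_or_ge a d with hd | hd
  · rw [genRow_of_le_of_lt _ _ hk hd]; exact h2 a hk hd ha
  obtain ⟨b, rfl⟩ := Nat.exists_eq_add_of_le hd
  rcases lt_or_ge b c with hb | hb
  · rw [genRow_add _ _ hkd hb]; exact h3 b hb (by omega)
  obtain ⟨e, rfl⟩ := Nat.exists_eq_add_of_le hb
  rw [← add_assoc, genRow_add_add e _ _ hkd]
  exact h4 e (by omega)

theorem map_eq_zero_of_mem_genRow {n c k d m : ℕ} {X Y : Matrix (Fin d) (Fin d) F} (hkd : k ≤ d)
    {E : Type*} [AddCommGroup E] [Module F E] (φ : (Fin n → F) →ₗ[F] E)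
    (h1 : ∀ a, a < k → a < m →
      φ (unitRow n (c + a) + shift F n (c + k) d (unitRow d a ᵥ* X)) = 0)
    (h2 : ∀ a, k ≤ a → a < d → a < m → φ (shift F n (c + k) d (unitRow d a ᵥ* Y)) = 0)
    (h3 : ∀ b, b < c → b < m - d → φ (unitRow n b) = 0)
    (h4 : ∀ a, a < m - d - c → φ (shift F n (c + k) d (unitRow d a ᵥ* Y)) = 0)
    {v : Fin n → F} (hv : v ∈ rowSpan (genRow n c k d X Y) m) : φ v = 0 :=
  rowSpan_genRow_le (K := LinearMap.ker φ) hkd h1 h2 h3 h4 hv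

/-- The row sequence is taken up to `n`, one beyond the matrix: the extra row completes the closing
block to rows `0, …, k - 1` of `Y`. With rows `k, …, d - 1` above it, all of the invertible `Y` is
present. -/
theorem rowSpan_genRow_eq_top {n c k d : ℕ} (hn : n = c + k + d) (hkd : k ≤ d)
    {X Y : Matrix (Fin d) (Fin d) F} (hY : IsUnit Y) :
    rowSpan (genRow n c k d X Y) n = ⊤ := by
  set K := rowSpan (genRow n c k d X Y) n
  have hrow : ∀ a < n, genRow n c k d X Y a ∈ K := fun a ha => mem_rowSpan ha
  have hY1 : ∀ a < d, shift F n (c + k) d (unitRow d a ᵥ* Y) ∈ K := by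
    intro a ha
    rcases lt_or_ge a k with hk | hk
    · rw [← genRow_add_add a X Y hkd]; exact hrow _ (by omega)
    · rw [← genRow_of_le_of_lt X Y hk ha]; exact hrow _ (by omega)
  have hall : ∀ x : Fin d → F, shift F n (c + k) d x ∈ K := by
    have htop : K.comap (shift F n (c + k) d ∘ₗ Y.vecMulLinear) = ⊤ :=
      unitRows_span fun b hb => hY1 b hb
    intro x
    obtain ⟨Z, rfl⟩ := hY
    have : x ᵥ* (↑Z⁻¹ : Matrix (Fin d) (Fin d) F) ∈
      K.comap (shift F n (c + k) d ∘ₗ (Z : Matrix (Fin d) (Fin d) F).vecMulLinear) :=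
      htop ▸ Submodule.mem_top
    simpa [vecMul_vecMul] using this
  apply unitRows_span
  intro b hb
  rcases lt_or_ge b c with hc | hc
  · rw [← genRow_add X Y hkd hc]; exact hrow _ (by omega)
  obtain ⟨a, rfl⟩ := Nat.exists_eq_add_of_le hc
  rcases lt_or_ge a k with hk | hk
  · have := K.sub_mem (hrow a (by omega)) (hall (unitRow d a ᵥ* X))
    rwa [genRow_of_lt _ _ hk, add_sub_cancel_right] at this
  · obtain ⟨e, rfl⟩ := Nat.exists_eq_add_of_le hk
    rw [← add_assoc, ← shift_unitRow _ _ d _ (by omega)]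
    exact hall _

theorem coord_eq_zero_of_mem_genRow {n c k d m b : ℕ} (hkd : k ≤ d)
    {X Y : Matrix (Fin d) (Fin d) F} (hb : b < c) (hmb : m - d ≤ b) {v : Fin n → F}
    (hv : v ∈ rowSpan (genRow n c k d X Y) m) : coord F n b v = 0 := by
  refine map_eq_zero_of_mem_genRow hkd _ ?_ ?_ ?_ ?_ hv
  · intro a _ _
    rw [map_add, coord_unitRow_of_ne (by omega), coord_shift_of_lt (by omega), add_zero]
  · intro a _ _ _; exact coord_shift_of_lt (by omega) _
  · intro a _ _; exact coord_unitRow_of_ne (by omega)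
  · intro a _; exact coord_shift_of_lt (by omega) _

theorem exists_coord_ne_zero_genRow {n c k d m a : ℕ} (X Y : Matrix (Fin d) (Fin d) F)
    (hn : c + k ≤ n) (hak : a < k) (ham : a < m) :
    ∃ v ∈ rowSpan (genRow n c k d X Y) m, coord F n (c + a) v ≠ 0 := by
  refine ⟨_, mem_rowSpan ham, ?_⟩
  rw [genRow_of_lt _ _ hak, map_add, coord_unitRow (by omega), if_pos rfl,
    coord_shift_of_lt (by omega), add_zero]
  exact one_ne_zero

theorem unitRow_mem_genRow {n c k d m b : ℕ} (hkd : k ≤ d) (X Y : Matrix (Fin d) (Fin d) F)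
    (hb : b < c) (hbm : b < m - d) : unitRow n b ∈ rowSpan (genRow n c k d X Y) m := by
  rw [← genRow_add X Y hkd hb]
  exact mem_rowSpan (by omega)

/-- What is left of the last block of a row vector after subtracting the product of its identity
block, extended by zeros, with `X`. -/
def residual {n : ℕ} (c k d : ℕ) (X : Matrix (Fin d) (Fin d) F) :
    (Fin n → F) →ₗ[F] (Fin d → F) :=
  window F n (c + k) d - X.vecMulLinear ∘ₗ headWindow F n c k d

/-- The point of `residual` with parameter `Z`: it kills head rows built from `Z` and sees the
difference `X - Z` on those built from `X`. -/
theorem residual_head {n c k d a : ℕ} (hn : n = c + k + d) (ha : a < k)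
    (X Z : Matrix (Fin d) (Fin d) F) :
    residual c k d Z (unitRow n (c + a) + shift F n (c + k) d (unitRow d a ᵥ* X)) =
      unitRow d a ᵥ* (X - Z) := by
  simp only [residual, LinearMap.sub_apply, map_add, LinearMap.comp_apply]
  rw [window_unitRow_of_lt (by omega), window_shift (by omega), headWindow_unitRow ha (by omega),
    headWindow_shift, vecMul_sub]
  simp [sub_eq_add_neg, add_comm]

theorem residual_shift {n c k d : ℕ} (hn : n = c + k + d) (Z : Matrix (Fin d) (Fin d) F)
    (x : Fin d → F) : residual c k d Z (shift F n (c + k) d x) = x := by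
  simp only [residual, LinearMap.sub_apply, LinearMap.comp_apply]
  rw [window_shift (by omega), headWindow_shift]
  simp

theorem residual_unitRow {n c k d b : ℕ} (hb : b < c) (Z : Matrix (Fin d) (Fin d) F) :
    residual c k d Z (unitRow n b) = 0 := by
  simp only [residual, LinearMap.sub_apply, LinearMap.comp_apply]
  rw [window_unitRow_of_lt (by omega), headWindow_unitRow_of_lt hb]
  simp

/-- After `residual` and multiplication by the inverse of the block, the rows become zero or unit
rows with index other than `k - 1`; that index would only come from row `n - 1`, excluded by `m <
n`. The vector in question becomes minus unit row `k - 1`. -/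
theorem unitRow_notMem_genRow {n c k d m : ℕ} (hn : n = c + k + d) (hk : 0 < k) (hkd : k ≤ d)
    (hm : m < n) {X : Matrix (Fin d) (Fin d) F} (hX : IsUnit X) :
    unitRow n (c + (k - 1)) ∉ rowSpan (genRow n c k d X X) m := by
  obtain ⟨Z, rfl⟩ := hX
  intro hmem
  have hker : (coord F d (k - 1) ∘ₗ (↑Z⁻¹ : Matrix (Fin d) (Fin d) F).vecMulLinear ∘ₗ
      residual c k d (Z : Matrix (Fin d) (Fin d) F)) (unitRow n (c + (k - 1))) = 0 := by
    refine map_eq_zero_of_mem_genRow hkd _ ?_ ?_ ?_ ?_ hmem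
    · intro a ha _
      simp only [LinearMap.comp_apply]
      rw [residual_head hn ha]
      simp
    · intro a ha _ _
      simp only [LinearMap.comp_apply]
      rw [residual_shift hn]
      simp only [vecMulLinear_apply, vecMul_vecMul, Units.mul_inv, vecMul_one]
      exact coord_unitRow_of_ne (by omega)
    · intro b hb _
      simp only [LinearMap.comp_apply]
      rw [residual_unitRow hb]
      simp
    · intro a ha
      simp only [LinearMap.comp_apply]
      rw [residual_shift hn]
      simp only [vecMulLinear_apply, vecMul_vecMul, Units.mul_inv, vecMul_one]
      exact coord_unitRow_of_ne (by omega)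
  have h0 := residual_head hn (show k - 1 < k by omega) 0 (Z : Matrix (Fin d) (Fin d) F)
  rw [vecMul_zero, map_zero, add_zero, zero_sub, vecMul_neg] at h0
  simp only [LinearMap.comp_apply] at hker
  rw [h0] at hker
  simp only [vecMulLinear_apply, vecMul_vecMul, Units.mul_inv, vecMul_one,
    map_neg] at hker
  rw [coord_unitRow (by omega)] at hker
  simp at hker

/-- The first `d` rows contain every row of `X`, and an invertible matrix has no zero column. -/
theorem exists_last_coord_ne_zero_genRow {n c k d m : ℕ} (hn : n = c + k + d) (hd : 0 < d)
    (hm : d ≤ m) {X : Matrix (Fin d) (Fin d) F} (hX : IsUnit X) :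
    ∃ v ∈ rowSpan (genRow n c k d X X) m, coord F n (n - 1) v ≠ 0 := by
  by_contra! h
  have hlast : ∀ a < d, coord F d (d - 1) (unitRow d a ᵥ* X) = 0 := by
    intro a ha
    have := h _ (mem_rowSpan (w := genRow n c k d X X) (show a < m by omega))
    have hsh : coord F n (n - 1) (shift F n (c + k) d (unitRow d a ᵥ* X)) =
        coord F d (d - 1) (unitRow d a ᵥ* X) := by
      rw [coord_shift (by omega), if_pos (by omega)]
      congr 2
      omega
    rcases lt_or_ge a k with hk | hk
    · rwa [genRow_of_lt _ _ hk, map_add, coord_unitRow_of_ne (by omega), zero_add, hsh] at this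
    · rwa [genRow_of_le_of_lt _ _ hk ha, hsh] at this
  have htop : LinearMap.ker (coord F d (d - 1) ∘ₗ X.vecMulLinear) = ⊤ :=
    unitRows_span fun b hb => hlast b hb
  obtain ⟨Z, rfl⟩ := hX
  have hmem : unitRow d (d - 1) ᵥ* (↑Z⁻¹ : Matrix (Fin d) (Fin d) F) ∈
    LinearMap.ker (coord F d (d - 1) ∘ₗ (Z : Matrix (Fin d) (Fin d) F).vecMulLinear) :=
    htop ▸ Submodule.mem_top
  rw [LinearMap.mem_ker, LinearMap.comp_apply, vecMulLinear_apply, vecMul_vecMul, Units.inv_mul,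
    vecMul_one, coord_unitRow (by omega)] at hmem
  simp at hmem

theorem coord_eq_zero_of_mem_genRow_zero_one {n c k d m b : ℕ} (hkd : k ≤ d) (hb : c + k ≤ b)
    (h2 : ∀ a, k ≤ a → a < d → a < m → b ≠ c + k + a) (h4 : c + k + (m - d - c) ≤ b)
    (hm : m ≤ c + k + d) {v : Fin n → F}
    (hv : v ∈ rowSpan (genRow n c k d (0 : Matrix (Fin d) (Fin d) F) 1) m) :
    coord F n b v = 0 := by
  refine map_eq_zero_of_mem_genRow hkd _ ?_ ?_ ?_ ?_ hv
  · intro a _ _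
    rw [vecMul_zero, map_zero, add_zero]
    exact coord_unitRow_of_ne (by omega)
  · intro a hka had ham
    rw [vecMul_one, shift_unitRow _ _ _ _ had]
    exact coord_unitRow_of_ne (h2 a hka had ham)
  · intro a _ _; exact coord_unitRow_of_ne (by omega)
  · intro a ha
    rw [vecMul_one, shift_unitRow _ _ _ _ (by omega)]
    exact coord_unitRow_of_ne (by omega)

theorem unitRow_mem_genRow_one {n c k d m a : ℕ} (X : Matrix (Fin d) (Fin d) F) (hka : k ≤ a)
    (had : a < d) (ham : a < m) :
    unitRow n (c + k + a) ∈ rowSpan (genRow n c k d X 1) m := by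
  have := mem_rowSpan (w := genRow n c k d X 1) ham
  rwa [genRow_of_le_of_lt _ _ hka had, vecMul_one, shift_unitRow _ _ _ _ had] at this

/-- Two matrices with the same `c`, `k`, `d` have different row spaces in each dimension, if the
difference of their head blocks is invertible. -/
theorem rowSpan_genRow_ne {n c k d m : ℕ} (hn : n = c + k + d) (hk : 0 < k) (hkd : k ≤ d)
    (hm0 : 0 < m) (hm : m < n) {X X' Y' : Matrix (Fin d) (Fin d) F} (hXX' : IsUnit (X - X'))
    (hY' : Y' = X' ∨ X' = 0) :
    rowSpan (genRow n c k d X X) m ≠ rowSpan (genRow n c k d X' Y') m := by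
  classical
  intro heq
  let J : Finset (Fin d) :=
    Finset.univ.filter fun a => (k ≤ a.val ∧ a.val < m) ∨ a.val < m - d - c
  let T : Submodule F (Fin d → F) :=
    Submodule.span F (J.image fun a => unitRow d a.val ᵥ* Y' : Finset (Fin d → F))
  have hT : ∀ a, a < d → (k ≤ a ∧ a < m) ∨ a < m - d - c → unitRow d a ᵥ* Y' ∈ T := by
    intro a ha h
    apply Submodule.subset_span
    simp only [Finset.coe_image, Set.mem_image, Finset.mem_coe]
    exact ⟨⟨a, ha⟩, by simpa [J] using h, rfl⟩
  -- `residual` with parameter `X'` kills the second space's head rows, so only the tail rows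
  -- indexed by `J` survive.
  have hle : rowSpan (genRow n c k d X' Y') m ≤ T.comap (residual c k d X') := by
    refine rowSpan_genRow_le hkd ?_ ?_ ?_ ?_
    · intro a ha _
      rw [Submodule.mem_comap, residual_head hn ha, sub_self, vecMul_zero]
      exact T.zero_mem
    · intro a hka had ham
      rw [Submodule.mem_comap, residual_shift hn]
      exact hT a had (Or.inl ⟨hka, ham⟩)
    · intro b hb _
      rw [Submodule.mem_comap, residual_unitRow hb]
      exact T.zero_mem
    · intro a ha
      rw [Submodule.mem_comap, residual_shift hn]
      exact hT a (by omega) (Or.inr ha)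
  have hrows : ∀ a, a < d → a < m → unitRow d a ᵥ* (X - X') ∈ T := by
    intro a had ham
    have hmem : genRow n c k d X X a ∈ T.comap (residual c k d X') :=
      hle (heq ▸ mem_rowSpan ham)
    rcases lt_or_ge a k with hak | hak
    · rwa [genRow_of_lt _ _ hak, Submodule.mem_comap, residual_head hn hak] at hmem
    · rw [genRow_of_le_of_lt _ _ hak had, Submodule.mem_comap, residual_shift hn] at hmem
      rw [vecMul_sub]
      refine T.sub_mem hmem ?_
      rcases hY' with rfl | rfl
      · exact hT a had (Or.inl ⟨hak, ham⟩)
      · rw [vecMul_zero]; exact T.zero_mem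
  let I : Finset (Fin d) := Finset.univ.filter fun a => a.val < m
  have hI : I.card ≤ Module.finrank F T := by
    have hli : LinearIndependent F (fun a : I => unitRow d a.val.val ᵥ* (X - X')) := by
      have h1 : LinearIndependent F (fun a : Fin d => (X - X') a) :=
        Matrix.linearIndependent_rows_iff_isUnit.2 hXX'
      have h2 : (fun a : I => unitRow d a.val.val ᵥ* (X - X')) =
          (fun a : Fin d => (X - X') a) ∘ Subtype.val := by
        funext a
        exact unitRow_vecMul a.val.isLt _
      rw [h2]
      exact h1.comp _ Subtype.val_injective
    have h3 := finrank_span_eq_card hli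
    rw [Fintype.card_coe] at h3
    rw [← h3]
    apply Submodule.finrank_mono
    rw [Submodule.span_le]
    rintro _ ⟨a, rfl⟩
    exact hrows _ a.val.isLt (by have := a.2; simp only [I, Finset.mem_filter] at this; exact this.2)
  have hTJ : Module.finrank F T ≤ J.card :=
    (finrank_span_finset_le_card _).trans Finset.card_image_le
  -- The rows of `X - X'` indexed by `I` are independent vectors of `T`, which has dimension at most
  -- `J.card`. The index `min m k - 1` lies in `I` but not in `J`, since `m < n` leaves fewer than
  -- `k` closing rows.
  have hJI : J.card < I.card := by
    apply Finset.card_lt_card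
    rw [Finset.ssubset_iff_of_subset]
    · refine ⟨⟨min m k - 1, by omega⟩, ?_, ?_⟩
      · simp only [I, Finset.mem_filter, Finset.mem_univ, true_and]; omega
      · simp only [J, Finset.mem_filter, Finset.mem_univ, true_and]; omega
    · intro a
      simp only [I, J, Finset.mem_filter, Finset.mem_univ, true_and]
      omega
  omega

/-- A common vector with identity part `x` has last block both `x X` and `x X'`, so `x = 0`. -/
theorem rowSpan_genRow_inf_eq_bot {n c k d : ℕ} (hn : n = c + k + d) (hkd : k ≤ d)
    {X X' Y Y' : Matrix (Fin d) (Fin d) F} (hXX' : IsUnit (X - X')) :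
    rowSpan (genRow n c k d X Y) k ⊓ rowSpan (genRow n c k d X' Y') k = ⊥ := by
  rw [eq_bot_iff]
  rintro v ⟨hv, hv'⟩
  have hres : ∀ {Z W : Matrix (Fin d) (Fin d) F} {v : Fin n → F},
      v ∈ rowSpan (genRow n c k d Z W) k → residual c k d Z v = 0 := by
    intro Z W v hv
    refine map_eq_zero_of_mem_rowSpan _ (fun a ha => ?_) hv
    rw [genRow_of_lt _ _ ha, residual_head hn ha, sub_self, vecMul_zero]
  have h1 := hres hv
  have h2 := hres hv'
  simp only [residual, LinearMap.sub_apply, LinearMap.comp_apply, vecMulLinear_apply] at h1 h2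
  have h3 : headWindow F n c k d v ᵥ* (X - X') = 0 ᵥ* (X - X') := by
    rw [vecMul_sub, zero_vecMul, ← sub_eq_zero.1 h1, ← sub_eq_zero.1 h2, sub_self]
  have h4 : headWindow F n c k d v = 0 := vecMul_injective_of_isUnit hXX' h3
  rw [h4, zero_vecMul, sub_zero] at h1
  rw [Submodule.mem_bot]
  funext b
  rcases lt_or_ge b.val c with hb | hb
  · rw [← coord_val b v]
    exact coord_eq_zero_of_mem_genRow hkd hb (by omega) hv
  rcases lt_or_ge b.val (c + k) with hb' | hb'
  · have := congrFun h4 ⟨b.val - c, by omega⟩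
    simp only [headWindow, LinearMap.pi_apply] at this
    rw [if_pos (by omega), show c + (b.val - c) = b.val by omega, coord_val] at this
    exact this
  · have := congrFun h1 ⟨b.val - (c + k), by omega⟩
    simp only [window, LinearMap.pi_apply] at this
    rw [show c + k + (b.val - (c + k)) = b.val by omega, coord_val] at this
    exact this

/-- A vector of the space spanned by the first `k` rows vanishes if its coordinates in the
identity block do. -/
theorem eq_zero_of_mem_rowSpan_genRow {n c k d : ℕ} (hn : n = c + k + d) (hkd : k ≤ d)
    {X Y : Matrix (Fin d) (Fin d) F} {v : Fin n → F}
    (hv : v ∈ rowSpan (genRow n c k d X Y) k)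
    (h0 : ∀ b, c ≤ b → b < c + k → coord F n b v = 0) : v = 0 := by
  have h1 : residual c k d X v = 0 := by
    refine map_eq_zero_of_mem_rowSpan _ (fun a ha => ?_) hv
    rw [genRow_of_lt _ _ ha, residual_head hn ha, sub_self, vecMul_zero]
  have h4 : headWindow F n c k d v = 0 := by
    funext a
    simp only [headWindow, LinearMap.pi_apply]
    split_ifs
    · exact h0 _ (by omega) (by omega)
    · rfl
  simp only [residual, LinearMap.sub_apply, LinearMap.comp_apply, vecMulLinear_apply, h4,
    zero_vecMul, sub_zero] at h1
  funext b
  rw [← coord_val b v]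
  rcases lt_or_ge b.val c with hb | hb
  · exact coord_eq_zero_of_mem_genRow hkd hb (by omega) hv
  rcases lt_or_ge b.val (c + k) with hb' | hb'
  · exact h0 _ hb hb'
  · have := congrFun h1 ⟨b.val - (c + k), by omega⟩
    simp only [window, LinearMap.pi_apply] at this
    rw [show c + k + (b.val - (c + k)) = b.val by omega] at this
    exact this

end Rows

/-! ### Comparing matrices with different block structures, and with `M`. -/

section Generators

open Matrix

variable {F : Type*} [Field F]

theorem blockDiag_apply {s k h i : ℕ} (hi : i + 1 ≤ s)
    (X : Matrix (Fin (i * k + h)) (Fin (i * k + h)) F)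
    (x y : Fin ((s - i - 1) * k + k) ⊕ Fin (i * k + h)) :
    blockDiag hi X ((finSumFinEquiv.trans (finCongr (block_widths hi))) x)
      ((finSumFinEquiv.trans (finCongr (block_widths hi))) y) = fromBlocks 1 0 0 X x y := by
  simp only [blockDiag, reindex_apply, submatrix_apply, Equiv.symm_apply_apply]

theorem unitRow_vecMul_blockDiag_of_lt {s k h i j : ℕ} (hi : i + 1 ≤ s)
    (X : Matrix (Fin (i * k + h)) (Fin (i * k + h)) F) (hj : j < (s - i - 1) * k + k) :
    unitRow (s * k + h) j ᵥ* blockDiag hi X = unitRow (s * k + h) j := by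
  have hn := block_widths (k := k) (h := h) hi
  rw [unitRow_vecMul (by omega)]
  funext b
  obtain ⟨y, rfl⟩ := (finSumFinEquiv.trans (finCongr (block_widths hi))).surjective b
  have := blockDiag_apply hi X (Sum.inl ⟨j, hj⟩) y
  refine Eq.trans this ?_
  rcases y with y | y
  · simp [one_apply, unitRow, Fin.ext_iff, eq_comm]
  · simp only [fromBlocks_apply₁₂, Matrix.zero_apply, unitRow]
    rw [if_neg]
    simp only [Equiv.trans_apply, finSumFinEquiv_apply_right, finCongr_apply, Fin.val_cast,
      Fin.val_natAdd]
    omega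

theorem unitRow_vecMul_blockDiag_add {s k h i a : ℕ} (hi : i + 1 ≤ s)
    (X : Matrix (Fin (i * k + h)) (Fin (i * k + h)) F) (ha : a < i * k + h) :
    unitRow (s * k + h) ((s - i - 1) * k + k + a) ᵥ* blockDiag hi X =
      shift F (s * k + h) ((s - i - 1) * k + k) (i * k + h) (unitRow (i * k + h) a ᵥ* X) := by
  have hn := block_widths (k := k) (h := h) hi
  rw [unitRow_vecMul (by omega), unitRow_vecMul ha]
  funext b
  rw [← coord_val b (shift _ _ _ _ _), coord_shift b.isLt]
  obtain ⟨y, rfl⟩ := (finSumFinEquiv.trans (finCongr (block_widths hi))).surjective b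
  have := blockDiag_apply hi X (Sum.inr ⟨a, ha⟩) y
  refine Eq.trans this ?_
  rcases y with y | y
  · have := y.isLt
    simp
  · simp [coord_val]

theorem matA_mul_blockDiag {s k h i : ℕ} (hi1 : 1 ≤ i) (hi : i + 1 ≤ s)
    (X : Matrix (Fin (i * k + h)) (Fin (i * k + h)) F) (a : Fin (s * k + h - 1)) :
    (matA F s k h i * blockDiag hi X) a =
      genRow (s * k + h) ((s - i - 1) * k) k (i * k + h) X X a.val := by
  have hn := block_widths (k := k) (h := h) hi
  have hik : k ≤ i * k := Nat.le_mul_of_pos_left k hi1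
  have ha := a.isLt
  have hA : matA F s k h i a =
      if a.val < k then unitRow (s * k + h) ((s - i - 1) * k + a.val) +
        unitRow (s * k + h) ((s - i - 1) * k + k + a.val)
      else if a.val < i * k + h then unitRow (s * k + h) ((s - i - 1) * k + k + a.val)
      else if a.val < i * k + h + (s - i - 1) * k then unitRow (s * k + h) (a.val - (i * k + h))
      else unitRow (s * k + h)
        ((s - i - 1) * k + k + (a.val - (i * k + h) - (s - i - 1) * k)) := rfl
  rw [mul_apply_eq_vecMul, hA]
  simp only [genRow]
  split_ifs
  · rw [add_vecMul, unitRow_vecMul_blockDiag_of_lt _ _ (by omega),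
      unitRow_vecMul_blockDiag_add _ _ (by omega)]
  · rw [unitRow_vecMul_blockDiag_add _ _ (by omega)]
  · rw [unitRow_vecMul_blockDiag_of_lt _ _ (by omega)]
  · rw [unitRow_vecMul_blockDiag_add _ _ (by omega)]

theorem matB_apply {s k h i : ℕ} (hi1 : 1 ≤ i) (hi : i + 1 ≤ s) (a : Fin (s * k + h - 1)) :
    matB F s k h i a = genRow (s * k + h) ((s - i - 1) * k) k (i * k + h) 0 1 a.val := by
  have hn := block_widths (k := k) (h := h) hi
  have hik : k ≤ i * k := Nat.le_mul_of_pos_left k hi1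
  have ha := a.isLt
  have hB : matB F s k h i a =
      if a.val < k then unitRow (s * k + h) ((s - i - 1) * k + a.val)
      else if a.val < i * k + h then unitRow (s * k + h) ((s - i - 1) * k + k + a.val)
      else if a.val < i * k + h + (s - i - 1) * k then unitRow (s * k + h) (a.val - (i * k + h))
      else unitRow (s * k + h)
        ((s - i - 1) * k + k + (a.val - (i * k + h) - (s - i - 1) * k)) := rfl
  rw [hB]
  simp only [genRow, vecMul_zero, map_zero, add_zero, vecMul_one]
  split_ifs
  · rfl
  · rw [shift_unitRow _ _ _ _ (by omega)]
  · rfl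
  · rw [shift_unitRow _ _ _ _ (by omega)]

theorem firstRows_eq_rowSpan {n m N : ℕ} {W : Matrix (Fin N) (Fin n) F} {w : ℕ → Fin n → F}
    (hW : ∀ a, W a = w a.val) (hm : m ≤ N) : firstRows W m = rowSpan w m := by
  unfold firstRows rowSpan
  congr 1
  ext v
  constructor
  · rintro ⟨a, ha, rfl⟩; exact ⟨a, ha, hW a⟩
  · rintro ⟨a, ha, rfl⟩; exact ⟨⟨a, by omega⟩, ha, (hW ⟨a, by omega⟩).symm⟩

theorem coord_eq_zero_of_mem_reversed {n m b : ℕ} (hb : b + m < n) {v : Fin n → F}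
    (hv : v ∈ rowSpan (fun a => unitRow n (n - 1 - a)) m) : coord F n b v = 0 :=
  map_eq_zero_of_mem_rowSpan _ (fun _ _ => coord_unitRow_of_ne (by omega)) hv

theorem rowSpan_reversed_eq_top (n : ℕ) :
    rowSpan (fun a => (unitRow n (n - 1 - a) : Fin n → F)) n = ⊤ := by
  apply unitRows_span
  intro b hb
  have := mem_rowSpan (w := fun a => (unitRow n (n - 1 - a) : Fin n → F))
    (show n - 1 - b < n by omega)
  rwa [show n - 1 - (n - 1 - b) = b by omega] at this

theorem rowSpan_genRow_ne_reversed {n c k d m : ℕ} (hn : n = c + k + d) (hk : 0 < k)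
    (hkd : k ≤ d) (hm0 : 0 < m) (hm : m < n) (X Y : Matrix (Fin d) (Fin d) F) :
    rowSpan (genRow n c k d X Y) m ≠ rowSpan (fun a => unitRow n (n - 1 - a)) m := by
  intro heq
  rcases Nat.lt_or_ge d m with hdm | hdm
  · rcases Nat.eq_zero_or_pos c with hc | hc
    · obtain ⟨v, hv, hne⟩ := exists_coord_ne_zero_genRow (c := c) X Y (by omega : c + k ≤ n) hk hm0
      exact hne (coord_eq_zero_of_mem_reversed (by omega) (heq ▸ hv))
    · have hv := unitRow_mem_genRow (n := n) hkd X Y hc (m := m) (by omega)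
      have := coord_eq_zero_of_mem_reversed (b := 0) (by omega) (heq ▸ hv)
      rw [coord_unitRow (by omega)] at this
      simp at this
  · obtain ⟨v, hv, hne⟩ := exists_coord_ne_zero_genRow (c := c) X Y (by omega : c + k ≤ n) hk hm0
    exact hne (coord_eq_zero_of_mem_reversed (by omega) (heq ▸ hv))

theorem pos_of_mem_allowedDims {s k h m : ℕ} (hs : 2 ≤ s) (hk : 0 < k)
    (hm : m ∈ allowedDims s k h) : 0 < m := by
  have h2 : 2 * k ≤ s * k := Nat.mul_le_mul_right k hs
  rcases hm with hm | ⟨j, hj, _, rfl⟩ | hm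
  · omega
  · have := Nat.mul_le_mul_right k hj
    omega
  · omega

theorem lt_of_mem_allowedDims {s k h m : ℕ} (hs : 2 ≤ s) (hk : 0 < k)
    (hm : m ∈ allowedDims s k h) : m < s * k + h := by
  have h2 : 2 * k ≤ s * k := Nat.mul_le_mul_right k hs
  rcases hm with hm | ⟨j, _, hj, rfl⟩ | hm
  · omega
  · have := Nat.mul_le_mul_right k hj
    rw [add_mul] at this
    omega
  · omega

/-- Matrices from the different blocks `i` and `i' = i + e + 1`, where `s = i' + 1 + g`, have
different row spaces in each allowed dimension. -/
theorem rowSpan_genRow_ne_of_widths {n c c' d d' k h i e g m : ℕ} (hk : 0 < k) (hi : 1 ≤ i)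
    (hn : c + k + d = n) (hn' : c' + k + d' = n) (hd : d = i * k + h)
    (hd' : d' = i * k + e * k + k + h) (hc : c = e * k + k + g * k) (hc' : c' = g * k)
    (hieg : i + e + g ≠ 2) (hm0 : 0 < m) (hmn : m < n)
    (hm : m ≤ k + h ∨ (∃ j, 2 ≤ j ∧ j ≤ i + e + g ∧ m = j * k + h) ∨ n ≤ m + k)
    {X Y : Matrix (Fin d) (Fin d) F} {X' Y' : Matrix (Fin d') (Fin d') F}
    (hXY : (X = Y ∧ IsUnit X) ∨ (X = 0 ∧ Y = 1))
    (hXY' : (X' = Y' ∧ IsUnit X') ∨ (X' = 0 ∧ Y' = 1)) :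
    rowSpan (genRow n c k d X Y) m ≠ rowSpan (genRow n c' k d' X' Y') m := by
  have hik : k ≤ i * k := Nat.le_mul_of_pos_left k hi
  intro heq
  -- Up to dimension `d` the first space vanishes on its leading `c` columns, whereas row `0` of the
  -- second has a nonzero entry in column `c' < c`.
  have hsmall : ¬ m ≤ d := by
    intro hmd
    obtain ⟨v, hv, hne⟩ := exists_coord_ne_zero_genRow (c := c') (m := m) X' Y'
      (by omega : c' + k ≤ n) hk hm0
    exact hne (coord_eq_zero_of_mem_genRow (c := c) (by omega) (by omega) (by omega) (heq ▸ hv))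
  have key : ∀ b, b < n → unitRow n b ∈ rowSpan (genRow n c k d X Y) m →
      (∀ v ∈ rowSpan (genRow n c' k d' X' Y') m, coord F n b v = 0) → False := by
    intro b hb h1 h2
    have := h2 _ (heq ▸ h1)
    rw [coord_unitRow hb, if_pos rfl] at this
    exact one_ne_zero this
  rcases hm with hm | ⟨j, hj2, hjs, hmj⟩ | hm
  · omega
  · rcases Nat.lt_or_ge i j with hij | hij
    swap
    · have := Nat.mul_le_mul_right k hij
      omega
    obtain ⟨u, rfl⟩ := Nat.exists_eq_add_of_lt hij
    have huk : (i + u + 1) * k + h = i * k + u * k + k + h := by ring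
    have hu1 : u * k + k ≤ e * k + g * k := by
      have := Nat.mul_le_mul_right k (show u + 1 ≤ e + g by omega)
      rwa [add_mul, add_mul, one_mul] at this
    rw [huk] at hmj
    -- `g = 0` means that the second matrix belongs to `s - 1` and has no leading columns.
    rcases Nat.eq_zero_or_pos g with hg | hg
    · subst hg
      rw [zero_mul] at *
      rcases hXY' with ⟨rfl, hX'⟩ | ⟨rfl, rfl⟩
      · refine unitRow_notMem_genRow (m := m) (c := c') (by omega) hk (by omega) hmn hX' ?_
        rw [← heq]
        exact unitRow_mem_genRow (by omega) _ _ (by omega) (by omega)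
      -- For `B_{s-1}` the first `m` rows leave out columns `k, …, 2k - 1` and all columns from `k +
      -- m` on, in particular the last one.
      · have hzero : ∀ b, k ≤ b → (∀ a, k ≤ a → a < m → b ≠ k + a) →
            ∀ v ∈ rowSpan (genRow n c' k d' (0 : Matrix (Fin d') (Fin d') F) 1) m,
              coord F n b v = 0 := by
          intro b hkb hb v hv
          refine coord_eq_zero_of_mem_genRow_zero_one (by omega) (by omega) ?_ (by omega)
            (by omega) hv
          intro a hka _ ham
          have := hb a hka ham
          omega
        rcases Nat.lt_or_ge k d with hkd | hkd
        · have hlast := hzero (n - 1) (by omega) (fun a _ _ => by omega)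
          rcases hXY with ⟨rfl, hX⟩ | ⟨rfl, rfl⟩
          · obtain ⟨v, hv, hne⟩ := exists_last_coord_ne_zero_genRow (n := n) (c := c) (k := k)
              (m := m) (by omega) (by omega) (by omega) hX
            exact hne (hlast v (heq ▸ hv))
          · refine key (n - 1) (by omega) ?_ hlast
            have := unitRow_mem_genRow_one (n := n) (c := c) (m := m)
              (0 : Matrix (Fin d) (Fin d) F) (show k ≤ d - 1 by omega) (by omega) (by omega)
            rwa [show c + k + (d - 1) = n - 1 by omega] at this
        -- Here `d = k`, so `i = 1` and `h = 0`, and the last column no longer separates when the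
        -- first matrix is `B_1`. Excluding `s = 4` gives `e ≥ 2`; for `s = 4` and `h = 0` the
        -- matrices `B_1` and `B_3` do span the same space in dimension `2k`.
        · have hi1 : i = 1 := by
            by_contra hne
            have := Nat.mul_le_mul_right k (show 2 ≤ i by omega)
            omega
          have he : 2 * k ≤ e * k := Nat.mul_le_mul_right k (by omega)
          rcases Nat.eq_zero_or_pos u with hu | hu
          · subst hu
            rw [zero_mul] at *
            have hv := unitRow_mem_genRow_one (n := n) (c := c') (k := k) (a := k) (m := m)
              (0 : Matrix (Fin d') (Fin d') F) le_rfl (by omega) (by omega)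
            rw [← heq] at hv
            have := coord_eq_zero_of_mem_genRow (b := c' + k + k) (by omega) (by omega)
              (by omega) hv
            rw [coord_unitRow (by omega), if_pos rfl] at this
            exact one_ne_zero this
          · have huk' : k ≤ u * k := Nat.le_mul_of_pos_left k hu
            refine key k (by omega) (unitRow_mem_genRow (by omega) _ _ (by omega) (by omega)) ?_
            exact hzero k le_rfl (fun a _ _ => by omega)
    · have hgk : k ≤ g * k := Nat.le_mul_of_pos_left k hg
      -- Column `m - d'` (truncated subtraction) is the first leading column not yet reached by the
      -- second matrix.
      refine key (m - d') (by omega) (unitRow_mem_genRow (by omega) _ _ (by omega) (by omega)) ?_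
      exact fun v hv => coord_eq_zero_of_mem_genRow (by omega) (by omega) le_rfl hv
  · rcases hXY' with ⟨rfl, hX'⟩ | ⟨rfl, rfl⟩
    · refine unitRow_notMem_genRow (m := m) (c := c') (by omega) hk (by omega) hmn hX' ?_
      rw [← heq]
      exact unitRow_mem_genRow (by omega) _ _ (by omega) (by omega)
    -- The column of the row that would complete the closing block of `B_{i'}`. It lies in the
    -- identity block of the first matrix if `e = 0`, and in its leading columns otherwise.
    · have hzero : ∀ v ∈ rowSpan (genRow n c' k d' (0 : Matrix (Fin d') (Fin d') F) 1) m,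
          coord F n (c' + k + (k - 1)) v = 0 := by
        intro v hv
        exact coord_eq_zero_of_mem_genRow_zero_one (by omega) (by omega)
          (fun a _ _ _ => by omega) (by omega) (by omega) hv
      rcases Nat.eq_zero_or_pos e with he | he
      · subst he
        rw [zero_mul] at *
        obtain ⟨v, hv, hne⟩ := exists_coord_ne_zero_genRow (c := c) (m := m) X Y
          (by omega : c + k ≤ n) (show k - 1 < k by omega) (by omega)
        refine hne ?_
        rw [show c = c' + k by omega]
        exact hzero v (heq ▸ hv)
      · have hek : k ≤ e * k := Nat.le_mul_of_pos_left k he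
        exact key _ (by omega) (unitRow_mem_genRow (by omega) _ _ (by omega) (by omega)) hzero

theorem rowSpan_genRow_ne_of_lt {s k h i i' m : ℕ} (hs4 : s ≠ 4) (hhk : h < k) (hi : 1 ≤ i)
    (hii' : i < i') (hi' : i' + 1 ≤ s) (hm : m ∈ allowedDims s k h)
    {X Y : Matrix (Fin (i * k + h)) (Fin (i * k + h)) F}
    {X' Y' : Matrix (Fin (i' * k + h)) (Fin (i' * k + h)) F}
    (hXY : (X = Y ∧ IsUnit X) ∨ (X = 0 ∧ Y = 1))
    (hXY' : (X' = Y' ∧ IsUnit X') ∨ (X' = 0 ∧ Y' = 1)) :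
    rowSpan (genRow (s * k + h) ((s - i - 1) * k) k (i * k + h) X Y) m ≠
      rowSpan (genRow (s * k + h) ((s - i' - 1) * k) k (i' * k + h) X' Y') m := by
  have hm0 := pos_of_mem_allowedDims (by omega) (by omega) hm
  have hmn := lt_of_mem_allowedDims (by omega) (by omega) hm
  obtain ⟨e, rfl⟩ := Nat.exists_eq_add_of_lt hii'
  obtain ⟨g, rfl⟩ := Nat.exists_eq_add_of_le hi'
  refine rowSpan_genRow_ne_of_widths (by omega) hi (block_widths (by omega))
    (block_widths (by omega)) rfl (by ring) (h := h) (e := e) (g := g) ?_ ?_ (by omega) hm0 hmn ?_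
    hXY hXY'
  · rw [show i + e + 1 + 1 + g - i - 1 = e + 1 + g by omega]; ring
  · rw [show i + e + 1 + 1 + g - (i + e + 1) - 1 = g by omega]
  · rcases hm with hm | ⟨j, hj2, hjs, rfl⟩ | hm
    · exact Or.inl hm.2
    · exact Or.inr (Or.inl ⟨j, hj2, by omega, rfl⟩)
    · exact Or.inr (Or.inr hm.1)

/-- The identity columns for `i'` lie among the leading columns for `i`, where the `k`-space for `i`
vanishes. -/
theorem rowSpan_genRow_inf_eq_bot_of_lt {s k h i i' : ℕ} (hi : 1 ≤ i)
    (hii' : i < i') (hi' : i' + 1 ≤ s)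
    {X Y : Matrix (Fin (i * k + h)) (Fin (i * k + h)) F}
    {X' Y' : Matrix (Fin (i' * k + h)) (Fin (i' * k + h)) F} :
    rowSpan (genRow (s * k + h) ((s - i - 1) * k) k (i * k + h) X Y) k ⊓
      rowSpan (genRow (s * k + h) ((s - i' - 1) * k) k (i' * k + h) X' Y') k = ⊥ := by
  rw [eq_bot_iff]
  rintro v ⟨hv, hv'⟩
  have hik : k ≤ i * k := Nat.le_mul_of_pos_left k hi
  have hik' : k ≤ i' * k := Nat.le_mul_of_pos_left k (by omega)
  have hcc : (s - i' - 1) * k + k ≤ (s - i - 1) * k := by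
    have := Nat.mul_le_mul_right k (show s - i' - 1 + 1 ≤ s - i - 1 by omega)
    rwa [add_mul, one_mul] at this
  exact eq_zero_of_mem_rowSpan_genRow (block_widths hi').symm (by omega) hv' fun b _ hb =>
    coord_eq_zero_of_mem_genRow (by omega) (by omega) (by omega) hv

theorem rowSpan_genRow_inf_reversed {n c k d : ℕ} (hn : n = c + k + d)
    (hkd : k ≤ d) (X Y : Matrix (Fin d) (Fin d) F) :
    rowSpan (genRow n c k d X Y) k ⊓ rowSpan (fun a => unitRow n (n - 1 - a)) k = ⊥ := by
  rw [eq_bot_iff]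
  rintro v ⟨hv, hv'⟩
  refine eq_zero_of_mem_rowSpan_genRow hn hkd hv fun b _ hb => ?_
  rcases Nat.lt_or_ge (b + k) n with h | h
  · exact coord_eq_zero_of_mem_reversed h hv'
  · omega

end Generators

/-! ### Labels, injectivity in each dimension, and cardinalities. -/

section Code

variable {F : Type*} [Field F]

/-- The labels of the generator matrices: `none` for `M`, `some ⟨i, none⟩` for `B_{i+1}` and
`some ⟨i, some X⟩` for `A_{i+1} g`, where `X` is the last block of `g`. -/
abbrev GenIndex (s k h : ℕ) (f : ℕ → F[X]) : Type _ :=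
  Option (Σ i : Fin (s - 1),
    Option (Submonoid.powers (companion ((i.val + 1) * k + h) (f (i.val + 1)))))

/-- The matrix with entries in the first `k` rows of the last block. -/
def headBlock {d : ℕ} {P : Matrix (Fin d) (Fin d) F} (x : Option (Submonoid.powers P)) :
    Matrix (Fin d) (Fin d) F :=
  x.elim 0 Subtype.val

/-- The matrix with entries in the other rows of the last block. -/
def tailBlock {d : ℕ} {P : Matrix (Fin d) (Fin d) F} (x : Option (Submonoid.powers P)) :
    Matrix (Fin d) (Fin d) F :=
  x.elim 1 Subtype.val

/-- The rows of the generator matrix with a given label, continued to a basis of `F ^ n`. -/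
def indexRow {s k h : ℕ} {f : ℕ → F[X]} : GenIndex s k h f → ℕ → Fin (s * k + h) → F
  | none => fun a => unitRow (s * k + h) (s * k + h - 1 - a)
  | some ⟨i, x⟩ => genRow (s * k + h) ((s - (i.val + 1) - 1) * k) k ((i.val + 1) * k + h)
      (headBlock x) (tailBlock x)

theorem mem_generatorMatrices_iff {s k h : ℕ} {f : ℕ → F[X]}
    (W : Matrix (Fin (s * k + h - 1)) (Fin (s * k + h)) F) :
    W ∈ generatorMatrices s k h f ↔ ∃ x : GenIndex s k h f, ∀ a, W a = indexRow x a.val := by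
  constructor
  · rintro (⟨i, ⟨hi1, hi⟩, rfl | ⟨_, ⟨X, hX, rfl⟩, rfl⟩⟩ | rfl)
    · obtain ⟨i, rfl⟩ := Nat.exists_eq_add_of_le' hi1
      exact ⟨some ⟨⟨i, by omega⟩, none⟩, matB_apply hi1 hi⟩
    · obtain ⟨i, rfl⟩ := Nat.exists_eq_add_of_le' hi1
      exact ⟨some ⟨⟨i, by omega⟩, some ⟨X, hX⟩⟩, matA_mul_blockDiag hi1 hi X⟩
    · exact ⟨none, fun a => rfl⟩
  · rintro ⟨_ | ⟨i, _ | ⟨X, hX⟩⟩, h⟩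
    · exact Or.inr (funext h)
    · have := i.isLt
      refine Or.inl ⟨i.val + 1, ⟨by omega, by omega⟩, Or.inl (funext fun a => ?_)⟩
      exact (h a).trans (matB_apply (by omega) (by omega) a).symm
    · have := i.isLt
      refine Or.inl ⟨i.val + 1, ⟨by omega, by omega⟩, Or.inr ⟨_, ⟨X, hX, rfl⟩, funext fun a => ?_⟩⟩
      exact (h a).trans (matA_mul_blockDiag (by omega) (by omega) X a).symm

theorem codeC_eq_range {s k h : ℕ} {f : ℕ → F[X]} {r : ℕ} {t : Fin r → ℕ}
    (ht : ∀ i, t i ≤ s * k + h - 1) :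
    codeC s k h f t = Set.range fun (x : GenIndex s k h f) i => rowSpan (indexRow x) (t i) := by
  ext 𝓕
  constructor
  · rintro ⟨W, hW, rfl⟩
    obtain ⟨x, hx⟩ := (mem_generatorMatrices_iff W).1 hW
    exact ⟨x, funext fun i => (firstRows_eq_rowSpan hx (ht i)).symm⟩
  · rintro ⟨x, rfl⟩
    exact ⟨Matrix.of fun a => indexRow x a.val, (mem_generatorMatrices_iff _).2 ⟨x, fun a => rfl⟩,
      funext fun i => firstRows_eq_rowSpan (fun a => rfl) (ht i)⟩

variable [Fintype F] {s k h : ℕ} {f : ℕ → F[X]}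

/-- The polynomials `f i`, for `1 ≤ i ≤ s - 1`, are primitive of degree `i k + h`. -/
abbrev PrimitiveFamily (s k h : ℕ) (f : ℕ → F[X]) : Prop :=
  ∀ i, 1 ≤ i → i ≤ s - 1 → IsPrimitivePoly (f i) ∧ (f i).natDegree = i * k + h

theorem head_tail_cases (hf : PrimitiveFamily s k h f) (hk : 0 < k) {i : Fin (s - 1)}
    (x : Option (Submonoid.powers (companion ((i.val + 1) * k + h) (f (i.val + 1))))) :
    (headBlock x = tailBlock x ∧ IsUnit (headBlock x)) ∨
      (headBlock x = 0 ∧ tailBlock x = 1) := by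
  rcases x with _ | ⟨X, hX⟩
  · exact Or.inr ⟨rfl, rfl⟩
  · have := hf (i.val + 1) (by omega) (by omega)
    exact Or.inl ⟨rfl, isUnit_of_mem_powers_companion
      (Nat.add_pos_left (Nat.mul_pos (by omega) hk) _) this.1 this.2 hX⟩

theorem isUnit_tailBlock (hf : PrimitiveFamily s k h f) (hk : 0 < k) {i : Fin (s - 1)}
    (x : Option (Submonoid.powers (companion ((i.val + 1) * k + h) (f (i.val + 1))))) :
    IsUnit (tailBlock x) := by
  rcases head_tail_cases hf hk x with ⟨h1, h2⟩ | ⟨-, h2⟩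
  · exact h1 ▸ h2
  · exact h2 ▸ isUnit_one

theorem isUnit_headBlock_sub (hf : PrimitiveFamily s k h f) (hk : 0 < k) {i : Fin (s - 1)}
    {x y : Option (Submonoid.powers (companion ((i.val + 1) * k + h) (f (i.val + 1))))}
    (hxy : x ≠ y) : IsUnit (headBlock x - headBlock y) := by
  have hfi := hf (i.val + 1) (by omega) (by omega)
  have hd : 0 < (i.val + 1) * k + h := Nat.add_pos_left (Nat.mul_pos (by omega) hk) _
  rcases x with _ | ⟨X, hX⟩ <;> rcases y with _ | ⟨Y, hY⟩
  · exact absurd rfl hxy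
  · simpa [headBlock] using (isUnit_of_mem_powers_companion hd hfi.1 hfi.2 hY).neg
  · simpa [headBlock] using isUnit_of_mem_powers_companion hd hfi.1 hfi.2 hX
  · refine isUnit_sub_of_mem_powers_companion hd hfi.1 hfi.2 hX hY fun h => hxy ?_
    subst h
    rfl

theorem indexRow_widths (i : Fin (s - 1)) :
    s * k + h = (s - (i.val + 1) - 1) * k + k + ((i.val + 1) * k + h) :=
  (block_widths (by omega)).symm

theorem le_indexRow_width (i : Fin (s - 1)) : k ≤ (i.val + 1) * k + h :=
  (Nat.le_mul_of_pos_left k (Nat.succ_pos _)).trans (Nat.le_add_right _ _)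

theorem finrank_rowSpan_indexRow (hf : PrimitiveFamily s k h f) (hk : 0 < k)
    (x : GenIndex s k h f) {m : ℕ} (hm : m ≤ s * k + h) :
    Module.finrank F (rowSpan (indexRow x) m) = m := by
  refine finrank_rowSpan ?_ hm
  rcases x with _ | ⟨i, x⟩
  · exact rowSpan_reversed_eq_top _
  · exact rowSpan_genRow_eq_top (indexRow_widths i) (le_indexRow_width i)
      (isUnit_tailBlock hf hk x)

theorem rowSpan_indexRow_injective (hs : 2 ≤ s) (hs4 : s ≠ 4) (hhk : h < k)
    (hf : PrimitiveFamily s k h f) {m : ℕ} (hm : m ∈ allowedDims s k h) :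
    Function.Injective fun x : GenIndex s k h f => rowSpan (indexRow x) m := by
  have hk : 0 < k := by omega
  have hm0 := pos_of_mem_allowedDims hs hk hm
  have hmn := lt_of_mem_allowedDims hs hk hm
  intro x y hxy
  dsimp only at hxy
  rcases x with _ | ⟨i, x⟩ <;> rcases y with _ | ⟨i', y⟩
  · rfl
  · exact absurd hxy.symm (rowSpan_genRow_ne_reversed (indexRow_widths i') hk
      (le_indexRow_width i') hm0 hmn _ _)
  · exact absurd hxy (rowSpan_genRow_ne_reversed (indexRow_widths i) hk
      (le_indexRow_width i) hm0 hmn _ _)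
  · rcases lt_trichotomy i i' with hii' | rfl | hii'
    · exact absurd hxy (rowSpan_genRow_ne_of_lt hs4 hhk (by omega) (by simpa using hii')
        (by omega) hm (head_tail_cases hf hk x) (head_tail_cases hf hk y))
    · by_contra hne
      have hxy' : x ≠ y := fun h => hne (by rw [h])
      -- `rowSpan_genRow_ne` wants equal head and tail blocks on its left side, so the roles are
      -- swapped when `x` is the label of `B`. Two labels of `B` would make `0` a unit.
      rcases head_tail_cases hf hk x with ⟨h1, -⟩ | ⟨h1, h2⟩
      · refine rowSpan_genRow_ne (indexRow_widths i) hk (le_indexRow_width i) hm0 hmn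
          (isUnit_headBlock_sub hf hk hxy') (Y' := tailBlock y)
          ((head_tail_cases hf hk y).imp (fun h => h.1.symm) And.left) ?_
        refine Eq.trans ?_ hxy
        simp only [indexRow, ← h1]
      · rcases head_tail_cases hf hk y with ⟨h3, -⟩ | ⟨h3, -⟩
        · refine rowSpan_genRow_ne (indexRow_widths i) hk (le_indexRow_width i) hm0 hmn
            (isUnit_headBlock_sub hf hk hxy'.symm) (Y' := tailBlock x) (Or.inr h1) ?_
          refine Eq.trans ?_ hxy.symm
          simp only [indexRow, ← h3]
        · have hu := isUnit_headBlock_sub hf hk hxy'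
          have : Nonempty (Fin ((i.val + 1) * k + h)) :=
            ⟨⟨0, hk.trans_le (le_indexRow_width i)⟩⟩
          rw [h1, h3, sub_self] at hu
          exact not_isUnit_zero hu
    · exact absurd hxy.symm (rowSpan_genRow_ne_of_lt hs4 hhk (by omega) (by simpa using hii')
        (by omega) hm (head_tail_cases hf hk y) (head_tail_cases hf hk x))

theorem rowSpan_indexRow_inf_eq_bot (hk : 0 < k) (hf : PrimitiveFamily s k h f)
    {x y : GenIndex s k h f} (hxy : x ≠ y) :
    rowSpan (indexRow x) k ⊓ rowSpan (indexRow y) k = ⊥ := by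
  rcases x with _ | ⟨i, x⟩ <;> rcases y with _ | ⟨i', y⟩
  · exact absurd rfl hxy
  · rw [inf_comm]
    exact rowSpan_genRow_inf_reversed (indexRow_widths i') (le_indexRow_width i') _ _
  · exact rowSpan_genRow_inf_reversed (indexRow_widths i) (le_indexRow_width i) _ _
  · rcases lt_trichotomy i i' with hii' | rfl | hii'
    · exact rowSpan_genRow_inf_eq_bot_of_lt (by omega) (by simpa using hii') (by omega)
    · exact rowSpan_genRow_inf_eq_bot (indexRow_widths i) (le_indexRow_width i)
        (isUnit_headBlock_sub hf hk fun h => hxy (by rw [h]))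
    · rw [inf_comm]
      exact rowSpan_genRow_inf_eq_bot_of_lt (by omega) (by simpa using hii') (by omega)

/-- For each `i` the `q ^ (i k + h) - 1` powers and the one `B_i` add up to `q ^ (i k + h)`; `M` is
the final `1`. -/
theorem natCard_genIndex (hk : 0 < k) (hf : PrimitiveFamily s k h f) :
    Nat.card (GenIndex s k h f) =
      ∑ i ∈ Finset.Icc 1 (s - 1), Fintype.card F ^ (i * k + h) + 1 := by
  have hcard : ∀ i : Fin (s - 1), Nat.card
      (Option (Submonoid.powers (companion ((i.val + 1) * k + h) (f (i.val + 1))))) =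
        Fintype.card F ^ ((i.val + 1) * k + h) := by
    intro i
    have hfi := hf (i.val + 1) (by omega) (by omega)
    rw [Finite.card_option, natCard_powers_companion
      (hk.trans_le (le_indexRow_width i)) hfi.1 hfi.2]
    exact Nat.sub_add_cancel (Nat.one_le_pow _ _ Fintype.card_pos)
  rw [Finite.card_option, Nat.card_sigma, Finset.sum_congr rfl fun i _ => hcard i,
    Fin.sum_univ_eq_sum_range (fun i => Fintype.card F ^ ((i + 1) * k + h)),
    Finset.range_eq_Ico, Finset.sum_Ico_add' (fun i => Fintype.card F ^ (i * k + h))]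
  rfl

theorem sum_pow_mul_sub_one (q : ℤ) (k h : ℕ) {s : ℕ} (hs : 1 ≤ s) :
    (∑ i ∈ Finset.Icc 1 (s - 1), q ^ (i * k + h)) * (q ^ k - 1) =
      q ^ (s * k + h) - q ^ (k + h) := by
  induction s, hs using Nat.le_induction with
  | base => simp
  | succ s hs ih =>
    obtain ⟨u, rfl⟩ := Nat.exists_eq_add_of_le' hs
    simp only [Nat.add_sub_cancel] at ih ⊢
    rw [Finset.sum_Icc_succ_top (by omega), add_mul, ih]
    ring

theorem ncard_partialSpread_le (hs : 2 ≤ s) {θ : ℕ}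
    (hθ : (θ : ℤ) * ((Fintype.card F : ℤ) - 1) = (Fintype.card F : ℤ) ^ h - 1) (hθk : θ < k)
    {S : Set (Submodule F (Fin (s * k + h) → F))} (hS : IsPartialSpread k S) :
    S.ncard ≤ ∑ i ∈ Finset.Icc 1 (s - 1), Fintype.card F ^ (i * k + h) + 1 := by
  have hfin : S.Finite := Set.toFinite S
  rw [Set.ncard_eq_toFinset_card S hfin]
  have hks : k ≤ s * k := Nat.le_mul_of_pos_left k (by omega)
  refine card_partialSpread_le (F := F) (k := k) (h := h) (θ := θ) ?_ ?_ ?_ ?_ ?_ hθ hθk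
  · intro U hU
    exact hS.1 U (hfin.mem_toFinset.1 hU)
  · intro U hU U' hU'
    exact hS.2 U (hfin.mem_toFinset.1 hU) U' (hfin.mem_toFinset.1 hU')
  · refine Finset.dvd_sum fun i hi => pow_dvd_pow _ ?_
    exact (Nat.le_mul_of_pos_left k (Finset.mem_Icc.1 hi).1).trans (Nat.le_add_right _ _)
  · rw [Module.finrank_fin_fun]; omega
  · rw [Module.finrank_fin_fun]
    push_cast
    exact sum_pow_mul_sub_one _ k h (by omega)

end Code

end FlagCodes

/-! ### The theorem on the code. -/

theorem corollary3p5 {F : Type*} [Field F] [Fintype F] (q : ℕ) (hq : Fintype.card F = q)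
    (s k h : ℕ) (hs : 2 ≤ s) (hs4 : s ≠ 4) (hhk : h < k)
    (f : ℕ → Polynomial F)
    (hf : ∀ i, 1 ≤ i → i ≤ s - 1 →
      FlagCodes.IsPrimitivePoly (f i) ∧ (f i).natDegree = i * k + h)
    {r : ℕ} (t : Fin r → ℕ) (ht : StrictMono t)
    (htsub : Set.range t ⊆ FlagCodes.allowedDims s k h)
    (j : Fin r) (hj : t j = k)
    (hk : ((q : ℚ) ^ h - 1) / ((q : ℚ) - 1) < (k : ℚ)) :
    FlagCodes.IsFlagCode t (FlagCodes.codeC s k h f t) ∧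
    FlagCodes.CardinalityConsistent (FlagCodes.codeC s k h f t) ∧
    FlagCodes.IsPartialSpread k
      (FlagCodes.projectedCode (FlagCodes.codeC s k h f t) j) ∧
    (FlagCodes.codeC s k h f t).ncard = ∑ i ∈ Finset.Icc 1 (s - 1), q ^ (i * k + h) + 1 ∧
    ((FlagCodes.codeC s k h f t).ncard : ℚ) =
      ((q : ℚ) ^ (s * k + h) - (q : ℚ) ^ (k + h)) / ((q : ℚ) ^ k - 1) + 1 ∧
    ∀ C' : Set (Fin r → Submodule F (Fin (s * k + h) → F)),
      FlagCodes.IsFlagCode t C' →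
      FlagCodes.CardinalityConsistent C' →
      FlagCodes.IsPartialSpread k (FlagCodes.projectedCode C' j) →
      C'.ncard ≤ (FlagCodes.codeC s k h f t).ncard := by
  open FlagCodes in
  subst hq
  have hk0 : 0 < k := by omega
  have hq1 : 1 < Fintype.card F := Fintype.one_lt_card
  have htm : ∀ i, t i ∈ allowedDims s k h := fun i => htsub ⟨i, rfl⟩
  have hpos : ∀ i, 0 < t i := fun i => pos_of_mem_allowedDims hs hk0 (htm i)
  have hlt : ∀ i, t i < s * k + h := fun i => lt_of_mem_allowedDims hs hk0 (htm i)
  have hcode := codeC_eq_range (f := f) (t := t) (s := s) (k := k) (h := h)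
    fun i => Nat.le_sub_one_of_lt (hlt i)
  have hinj : ∀ i, Function.Injective fun x : GenIndex s k h f => rowSpan (indexRow x) (t i) :=
    fun i => rowSpan_indexRow_injective hs hs4 hhk hf (htm i)
  have hproj : ∀ i, projectedCode (codeC s k h f t) i =
      Set.range fun x : GenIndex s k h f => rowSpan (indexRow x) (t i) := by
    intro i
    rw [projectedCode, hcode, ← Set.range_comp]
    rfl
  have hncard : (codeC s k h f t).ncard = Nat.card (GenIndex s k h f) := by
    rw [hcode]
    exact Set.ncard_range_of_injective fun x y hxy => hinj j (congrFun hxy j)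
  have hcard := natCard_genIndex hk0 hf
  have hfr : ∀ (x : GenIndex s k h f) i, Module.finrank F (rowSpan (indexRow x) (t i)) = t i :=
    fun x i => finrank_rowSpan_indexRow hf hk0 x (hlt i).le
  refine ⟨⟨?_, ?_⟩, ?_, ⟨?_, ?_⟩, hncard.trans hcard, ?_, ?_⟩
  · rw [hcode]
    exact Set.range_nonempty _
  · rw [hcode]
    rintro _ ⟨x, rfl⟩
    refine ⟨fun a b hab => ?_, fun i => ⟨?_, ?_⟩, hfr x⟩
    · refine lt_of_le_of_ne (rowSpan_mono _ (ht hab).le) fun heq => (ht hab).ne ?_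
      rw [← hfr x a, ← hfr x b]
      exact congrArg (fun U : Submodule F (Fin (s * k + h) → F) => Module.finrank F U) heq
    · rw [bot_lt_iff_ne_bot]
      intro h0
      have := hfr x i
      simp only at h0
      rw [h0, finrank_bot] at this
      exact (hpos i).ne this
    · rw [lt_top_iff_ne_top]
      intro h0
      have := hfr x i
      simp only at h0
      rw [h0, finrank_top, Module.finrank_fin_fun] at this
      exact (hlt i).ne' this
  · intro i
    rw [hproj, hncard, Set.ncard_range_of_injective (hinj i)]
  · rw [hproj]
    rintro _ ⟨x, rfl⟩
    exact (hfr x j).trans hj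
  · rw [hproj, hj]
    rintro _ ⟨x, rfl⟩ _ ⟨y, rfl⟩ hne
    exact rowSpan_indexRow_inf_eq_bot hk0 hf fun h => hne (by rw [h])
  · rw [hncard, hcard]
    have h1 := sum_pow_mul_sub_one (Fintype.card F : ℤ) k h (s := s) (by omega)
    have h2 : (1 : ℚ) < (Fintype.card F : ℚ) ^ k := by
      exact_mod_cast Nat.one_lt_pow hk0.ne' hq1
    push_cast
    rw [add_left_inj, eq_div_iff (by linarith)]
    exact_mod_cast h1
  · intro C' _ hcc hps
    rw [hncard, hcard, ← hcc j]
    have hgeom := geom_sum_mul (Fintype.card F : ℤ) h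
    -- The geometric sum is the integer form of `(q ^ h - 1) / (q - 1)`.
    refine ncard_partialSpread_le hs (θ := ∑ i ∈ Finset.range h, Fintype.card F ^ i) ?_ ?_ hps
    · exact_mod_cast hgeom
    · have h2 : (1 : ℚ) < (Fintype.card F : ℚ) := by exact_mod_cast hq1
      rw [div_lt_iff₀ (by linarith), ← geom_sum_mul] at hk
      have := lt_of_mul_lt_mul_right hk (by linarith)
      exact_mod_cast this
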